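/- Let $1\to A\xrightarrow{\alpha}B\xrightarrow{\beta}C\to 1$ be a central extension of Lie groups (with $\beta$ a smooth principal $A$-bundle, as is automatic for finite-dimensional second countable Lie groups), with Lie algebras $\mathfrak a,\mathfrak b,\mathfrak c$. Assume a splitting that is equivariant under the adjoint action of $B$: continuous linear maps $s\colon\mathfrak c\to\mathfrak b$, $t\colon\mathfrak b\to\mathfrak a$ with $\beta_*s=1$, $t\alpha_*=1$, $\alpha_*t+s\beta_*=1$ and $s\circ\mathrm{Ad}_{\beta(b)}=\mathrm{Ad}_b\circ s$ for all $b\in B$. Let $G$ be a Lie group acting smoothly on a manifold $X$, and let $\pi\colon P\to X$ be a $G$-equivariant principal $C$-bundle with a $G$-equivariant connection $\omega^\pi\in\Omega^1(P;\mathfrak c)$. The lifting gerbe $\mathcal G_\pi$ is the $G$-equivariant $A$-gerbe on $X$ given by $P\to X$ and the principal $A$-bundle $Q_P=\{(p_1,p_2,b)\in P\times P\times B : p_1\beta(b)=p_2\}\to P\times_XP$, with $A$-action $(p_1,p_2,b)a=(p_1,p_2,b\,\alpha(a))$, $G$-action $g(p_1,p_2,b)=(gp_1,gp_2,b)$, multiplication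 $(p_1,p_2,b)\cdot(p_2,p_3,b')=(p_1,p_3,bb')$, and connective structure the connection $\omega^{Q_P}$ that is the pullback along $(p_1,p_2,b)\mapsto b$ of the form $T_bB\ni\xi\mapsto t(b^{-1}\xi)$. A parallel $G$-equivariant trivialization of $\mathcal G_\pi$ is a $G$-equivariant principal $A$-bundle $\sigma\colon R\to P$ with a $G$-equivariant connection $\omega^\sigma$ and a $G$-equivariant, connection-preserving isomorphism $\psi\colon R\times^AR\to Q_P$ of $A$-bundles over $P\times_XP$ with $\psi[r_1,r_2]\cdot\psi[r_2,r_3]=\psi[r_1,r_3]$. Here the fibre of $R\times^AR$ over $(p_1,p_2)$ consists of the classes $[r_1,r_2]=[r_1a,r_2a]$ with $\sigma(r_i)=p_i$, the $A$-action is $[r_1,r_2]a=[r_1,r_2a]$, and connection-preserving means $\mathrm{pr}_2^*\omega^\sigma-\mathrm{pr}_1^*\omega^\sigma=\psi^*\omega^{Q_P}$ on $R\times_XR$. A $G$-equivariant central extension of $\pi$ with admissible connection is a $G$-equivariant principal $B$-bundle $\rho\colon R\to X$ with a smooth $G$-equivariant map $\sigma\colon R\to P$ over $X$ satisfying $\sigma(rb)=\sigma(r)\beta(b)$,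 and a $G$-equivariant connection $\omega^\rho$ on $\rho$ with $\beta_*(\omega^\rho)=\sigma^*\omega^\pi$. Then the parallel $G$-equivariant trivializations of $\mathcal G_\pi$ are in one-to-one correspondence with the $G$-equivariant central extensions $\rho\colon R\xrightarrow{\sigma}P\xrightarrow{\pi}X$ with admissible $G$-equivariant connection. More precisely, for every manifold $R$ with smooth $G$-action, the assignment that sends $(\rho,\sigma,\omega^\rho)$ on $R$ to the map $\sigma$ with the $A$-action $ra=r\,\alpha(a)$, the connection $\omega^\sigma=t\circ\omega^\rho$, and $\psi[r_1,r_2]=(\sigma(r_1),\sigma(r_2),b)$ where $r_1b=r_2$, is a bijection between the two kinds of structure with total space $R$. A diffeomorphism $R\to R'$ is an isomorphism of central extensions with connection (that is, $G$- and $B$-equivariant, over $P$, and preserving the connections) if and only if it is an isomorphism of the corresponding trivializations (that is, $G$- and $A$-equivariant, over $P$, and preserving the connections and $\psi$); so the assignment induces a bijection between isomorphism classes. -/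

import Mathlib

open scoped Manifold ContDiff Topology

universe u v u₁ v₁ u₂ v₂ u₃ v₃ u₄ v₄

namespace LiftingGerbe

noncomputable section


/-! ### Smooth manifolds with a smooth left action of a Lie group -/

/-- A smooth manifold without boundary. -/
structure SmoothManifold where
  carrier : Type u
  E : Type v
  H : Type v
  [normedE : NormedAddCommGroup E]
  [spaceE : NormedSpace ℝ E]
  [topH : TopologicalSpace H]
  I : ModelWithCorners ℝ E H
  [boundaryless : I.Boundaryless]
  [top : TopologicalSpace carrier]
  [charted : ChartedSpace H carrier]
  [smooth : IsManifold I ∞ carrier]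

instance : CoeSort SmoothManifold.{u, v} (Type u) := ⟨SmoothManifold.carrier⟩

attribute [instance] SmoothManifold.normedE SmoothManifold.spaceE SmoothManifold.topH
  SmoothManifold.boundaryless SmoothManifold.top SmoothManifold.charted SmoothManifold.smooth

/-- A smooth manifold with a smooth left action of the Lie group `G` (modelled on `EG`). -/
structure GManifold (EG : Type*) [NormedAddCommGroup EG] [NormedSpace ℝ EG]
    (G : Type*) [TopologicalSpace G] [ChartedSpace EG G] [Group G]
    extends SmoothManifold.{u, v} where
  [action : MulAction G carrier]
  [smoothAction : ContMDiffSMul 𝓘(ℝ, EG) I ∞ G carrier]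

section GManifold

variable {EG : Type*} [NormedAddCommGroup EG] [NormedSpace ℝ EG]
  {G : Type*} [TopologicalSpace G] [ChartedSpace EG G] [Group G]

instance : CoeSort (GManifold.{u, v} EG G) (Type u) := ⟨fun M => M.carrier⟩

attribute [instance] GManifold.action GManifold.smoothAction

end GManifold

/-! ### Lie algebras of Lie groups -/

section LieAlgebra

variable (EK : Type*) [NormedAddCommGroup EK] [NormedSpace ℝ EK]
  (K : Type*) [TopologicalSpace K] [ChartedSpace EK K] [Group K]
  {EL : Type*} [NormedAddCommGroup EL] [NormedSpace ℝ EL]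
  {L : Type*} [TopologicalSpace L] [ChartedSpace EL L] [Group L]

/-- The Lie algebra of a Lie group `K` modelled on `EK`, as a topological vector space:
the tangent space at the identity. -/
abbrev LieAlg : Type _ := GroupLieAlgebra 𝓘(ℝ, EK) K

variable {K}

/-- The derivative at the identity of a homomorphism of Lie groups. -/
def lieMap (EL : Type*) [NormedAddCommGroup EL] [NormedSpace ℝ EL] [ChartedSpace EL L]
    (φ : K →* L) : LieAlg EK K →L[ℝ] LieAlg EL L :=
  (mfderiv 𝓘(ℝ, EK) 𝓘(ℝ, EL) φ 1 : EK →L[ℝ] EL)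

/-- The adjoint action `v ↦ k v k⁻¹`. -/
def Ad (k : K) : LieAlg EK K →L[ℝ] LieAlg EK K :=
  (mfderiv 𝓘(ℝ, EK) 𝓘(ℝ, EK) (fun x : K => k * x * k⁻¹) 1 : EK →L[ℝ] EK)

/-- The (left-invariant) Maurer-Cartan form `ξ ↦ k⁻¹ ξ` for `ξ ∈ T_k K`. -/
def maurerCartan (k : K) : TangentSpace 𝓘(ℝ, EK) k →L[ℝ] LieAlg EK K :=
  (mfderiv 𝓘(ℝ, EK) 𝓘(ℝ, EK) (fun x : K => k⁻¹ * x) k : EK →L[ℝ] EK)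

end LieAlgebra

/-! ### Differential one-forms with values in a Lie algebra -/

section OneForm

/-- A smooth one-form on `M` with values in the Lie algebra of `K`: a map `TM → Lie K` that is
smooth and linear on the fibres. -/
@[ext]
structure OneForm (M : SmoothManifold.{u, v})
    (EK : Type*) [NormedAddCommGroup EK] [NormedSpace ℝ EK]
    (K : Type*) [TopologicalSpace K] [ChartedSpace EK K] [Group K] where
  toFun : ∀ x : M, TangentSpace M.I x →L[ℝ] LieAlg EK K
  smooth : ContMDiff (M' := EK) M.I.tangent 𝓘(ℝ, EK) ∞
    (fun w : TangentBundle M.I M => toFun w.1 w.2)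

variable {M : SmoothManifold.{u, v}}
  {EK : Type*} [NormedAddCommGroup EK] [NormedSpace ℝ EK]
  {K : Type*} [TopologicalSpace K] [ChartedSpace EK K] [Group K]

/-- The value of a one-form on the velocity at time `0` of a curve. -/
def OneForm.along (η : OneForm M EK K) (c : ℝ → M) : LieAlg EK K :=
  η.toFun (c 0) (mfderiv 𝓘(ℝ, ℝ) M.I c 0 (1 : ℝ))

end OneForm

/-! ### Smooth maps on subsets, fibre bundles, principal bundles -/

section Bundles

variable {E₁ H₁ E₂ H₂ E₃ H₃ : Type*} [NormedAddCommGroup E₁] [NormedSpace ℝ E₁]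
  [TopologicalSpace H₁] [NormedAddCommGroup E₂] [NormedSpace ℝ E₂] [TopologicalSpace H₂]
  [NormedAddCommGroup E₃] [NormedSpace ℝ E₃] [TopologicalSpace H₃]
  (I₁ : ModelWithCorners ℝ E₁ H₁) (I₂ : ModelWithCorners ℝ E₂ H₂)
  (I₃ : ModelWithCorners ℝ E₃ H₃)
  {M : Type*} [TopologicalSpace M] [ChartedSpace H₁ M]
  {N : Type*} [TopologicalSpace N] [ChartedSpace H₂ N]
  {F : Type*} [TopologicalSpace F] [ChartedSpace H₃ F]

/-- Smoothness of a map on a subset `S` of a manifold: locally it is the restriction of a smooth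
map defined on an open subset of the ambient manifold. On an embedded submanifold (such as a fibre
product along a submersion) this is smoothness for the submanifold structure. -/
def SmoothOnSubset {S : Set M} (f : S → N) : Prop :=
  ∀ x : S, ∃ (U : Set M) (g : M → N), IsOpen U ∧ (x : M) ∈ U ∧ ContMDiffOn I₁ I₂ ∞ g U ∧
    ∀ y : S, (y : M) ∈ U → f y = g y

/-- `π : N → M` is a smooth fibre bundle with typical fibre `F`: over a neighbourhood `U` of every
point there is a diffeomorphism `π⁻¹(U) ≅ U × F` over `U`, given by `y ↦ (π y, k y)` with inverse
`j`. -/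
structure IsSmoothFibreBundle (π : N → M) : Prop where
  smooth : ContMDiff I₂ I₁ ∞ π
  locTriv : ∀ x : M, ∃ (U : Set M) (k : N → F) (j : M × F → N), IsOpen U ∧ x ∈ U ∧
    ContMDiffOn I₂ I₃ ∞ k (π ⁻¹' U) ∧
    ContMDiffOn (I₁.prod I₃) I₂ ∞ j (U ×ˢ Set.univ) ∧
    (∀ x ∈ U, ∀ t : F, π (j (x, t)) = x ∧ k (j (x, t)) = t) ∧
    ∀ y : N, π y ∈ U → j (π y, k y) = y

variable (EK : Type*) [NormedAddCommGroup EK] [NormedSpace ℝ EK]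
  {K : Type*} [TopologicalSpace K] [ChartedSpace EK K] [Group K]

/-- `π : N → S` is a smooth principal `K`-bundle over the embedded submanifold `S` of `M` (over
`M` itself when `S = Set.univ`), with right action `act : N → K → N`: over a neighbourhood in `S`
of every point of `S` there is a smooth section `s` such that `(x, k) ↦ s x · k` is a diffeomorphism
onto the preimage of this neighbourhood, with inverse `q ↦ (π q, h q)`. -/
structure IsPrincipalBundle (S : Set M) (π : N → M) (act : N → K → N) : Prop where
  smooth_proj : ContMDiff I₂ I₁ ∞ π
  proj_mem : ∀ q, π q ∈ S
  smooth_act : ContMDiff (I₂.prod 𝓘(ℝ, EK)) I₂ ∞ (fun z : N × K => act z.1 z.2)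
  act_one : ∀ q, act q 1 = q
  act_mul : ∀ q k l, act q (k * l) = act (act q k) l
  proj_act : ∀ q k, π (act q k) = π q
  locTriv : ∀ x ∈ S, ∃ (U : Set M) (s : M → N) (h : N → K), IsOpen U ∧ x ∈ U ∧
    ContMDiffOn I₁ I₂ ∞ s U ∧ ContMDiffOn I₂ 𝓘(ℝ, EK) ∞ h (π ⁻¹' U) ∧
    (∀ x ∈ S ∩ U, π (s x) = x ∧ ∀ k : K, h (act (s x) k) = k) ∧
    ∀ q, π q ∈ U → act (s (π q)) (h q) = q

/-- Connection one-forms for a right action `act` of `K` on `M`: `η (p · ξ) = ξ` for `ξ` in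
the Lie algebra, and `η (v · k) = k⁻¹ (η v) k`. -/
structure IsConnectionForm {M : SmoothManifold.{u, v}} (act : M → K → M)
    (η : OneForm M EK K) : Prop where
  vertical : ∀ (p : M) (ξ : LieAlg EK K),
    η.toFun (act p 1) (mfderiv 𝓘(ℝ, EK) M.I (act p) 1 ξ) = ξ
  equivariant : ∀ (p : M) (k : K) (w : TangentSpace M.I p),
    η.toFun (act p k) (mfderiv M.I M.I (fun q => act q k) p w) = Ad EK k⁻¹ (η.toFun p w)

end Bundles

section Equivariant

variable {EG : Type*} [NormedAddCommGroup EG] [NormedSpace ℝ EG]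
  {G : Type*} [TopologicalSpace G] [ChartedSpace EG G] [Group G]

/-- `G`-invariance of a one-form. -/
def OneForm.IsInvariant {M : GManifold.{u, v} EG G}
    {EK : Type*} [NormedAddCommGroup EK] [NormedSpace ℝ EK]
    {K : Type*} [TopologicalSpace K] [ChartedSpace EK K] [Group K]
    (η : OneForm M.toSmoothManifold EK K) : Prop :=
  ∀ (g : G) (x : M) (w : TangentSpace M.I x),
    η.toFun (g • x) (mfderiv M.I M.I (fun y : M => g • y) x w) = η.toFun x w

/-- A `G`-equivariant principal `K`-bundle `N → M`. -/
structure EquivariantBundle (M : GManifold.{u₁, v₁} EG G) (N : GManifold.{u₂, v₂} EG G)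
    (EK : Type*) [NormedAddCommGroup EK] [NormedSpace ℝ EK]
    (K : Type*) [TopologicalSpace K] [ChartedSpace EK K] [Group K] where
  proj : N → M
  act : N → K → N
  principal : IsPrincipalBundle M.I N.I EK Set.univ proj act
  proj_smul : ∀ (g : G) (q : N), proj (g • q) = g • proj q
  act_smul : ∀ (g : G) (q : N) (k : K), act (g • q) k = g • act q k

/-- A `G`-equivariant connection on a `G`-equivariant principal `K`-bundle. -/
structure EquivariantConnection {M : GManifold.{u₁, v₁} EG G} {N : GManifold.{u₂, v₂} EG G}
    {EK : Type*} [NormedAddCommGroup EK] [NormedSpace ℝ EK]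
    {K : Type*} [TopologicalSpace K] [ChartedSpace EK K] [Group K]
    (π : EquivariantBundle M N EK K) where
  form : OneForm N.toSmoothManifold EK K
  isConnection : IsConnectionForm EK π.act form
  invariant : form.IsInvariant

/-! ### Gerbes with connective structure -/

variable {EA : Type*} [NormedAddCommGroup EA] [NormedSpace ℝ EA]
  {A : Type*} [TopologicalSpace A] [ChartedSpace EA A] [CommGroup A]

/-- A `G`-equivariant `A`-gerbe on `X` with a `G`-equivariant connective structure. It consists of
a fibre bundle `Y → X`, a principal `A`-bundle `Q → Y ×_X Y`, an associative multiplication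
`pr₁₂^* Q ⊗ pr₂₃^* Q → pr₁₃^* Q` and a connection on `Q` for which the multiplication is
parallel. The multiplication is given on representatives `(f, g) ∈ Q × Q` with `f` over `(y₁, y₂)`
and `g` over `(y₂, y₃)`; that it is a homomorphism of `A`-bundles on the tensor product is
`mul_act`. That it is parallel is tested on velocities of curves `(f, g)`, which exhaust the
tangent vectors. -/
structure Gerbe (X : GManifold.{u₁, v₁} EG G) (EA : Type*) [NormedAddCommGroup EA] [NormedSpace ℝ EA]
    (A : Type*) [TopologicalSpace A] [ChartedSpace EA A] [CommGroup A] where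
  Y : GManifold.{u₂, v₂} EG G
  fibre : SmoothManifold.{u₄, v₄}
  proj : Y → X
  fibreBundle : IsSmoothFibreBundle X.I Y.I fibre.I (F := fibre) proj
  proj_smul : ∀ (g : G) (y : Y), proj (g • y) = g • proj y
  Q : GManifold.{u₃, v₃} EG G
  base : Q → Y × Y
  act : Q → A → Q
  principal : IsPrincipalBundle (Y.I.prod Y.I) Q.I EA {z : Y × Y | proj z.1 = proj z.2} base act
  base_smul : ∀ (g : G) (q : Q), base (g • q) = g • base q
  act_smul : ∀ (g : G) (q : Q) (a : A), act (g • q) a = g • act q a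
  mul : ∀ f g : Q, (base f).2 = (base g).1 → Q
  mul_smooth : SmoothOnSubset (Q.I.prod Q.I) Q.I
    (fun z : {z : Q × Q | (base z.1).2 = (base z.2).1} => mul z.1.1 z.1.2 z.2)
  base_mul : ∀ f g h, base (mul f g h) = ((base f).1, (base g).2)
  mul_act : ∀ f g a b h h', mul (act f a) (act g b) h' = act (mul f g h) (a * b)
  mul_assoc : ∀ f₁ f₂ f₃ h₁₂ h₂₃ h h',
    mul (mul f₁ f₂ h₁₂) f₃ h = mul f₁ (mul f₂ f₃ h₂₃) h'
  mul_smul : ∀ (k : G) (f g : Q) h h', mul (k • f) (k • g) h' = k • mul f g h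
  connection : OneForm Q.toSmoothManifold EA A
  isConnection : IsConnectionForm EA act connection
  invariant : connection.IsInvariant
  parallel : ∀ (f g : ℝ → Q) (h : ∀ t, (base (f t)).2 = (base (g t)).1),
    ContMDiffAt 𝓘(ℝ, ℝ) Q.I ∞ f 0 → ContMDiffAt 𝓘(ℝ, ℝ) Q.I ∞ g 0 →
    connection.along (fun t => mul (f t) (g t) (h t)) =
      connection.along f + connection.along g

/-- A parallel `G`-equivariant trivialization, with total space `R`, of a `G`-equivariant gerbe with
connective structure: a `G`-equivariant principal `A`-bundle `R → Y` with a `G`-equivariant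
connection, and a connection-preserving `G`-equivariant isomorphism `R ×^A R → Q` of `A`-bundles over
`Y ×_X Y` that is compatible with the multiplication. The fibre of `R ×^A R` over `(y₁, y₂)` consists
of the classes `[r₁, r₂] = [r₁ a, r₂ a]` with `r₁` over `y₁` and `r₂` over `y₂`, the `A`-action is
`[r₁, r₂] a = [r₁, r₂ a]`, and the tensor product connection is
`[v₁, v₂] ↦ η v₂ - η v₁`. The isomorphism is given on representatives as
`hom r₁ r₂`; that it descends to classes and is `A`-equivariant is `hom_act`. -/
@[ext]
structure ParallelTrivialization {X : GManifold.{u₁, v₁} EG G}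
    (𝒢 : Gerbe.{u₁, v₁, u₂, v₂, u₃, v₃, u₄, v₄} X EA A)
    (R : GManifold.{u, v} EG G) where
  bundle : EquivariantBundle 𝒢.Y R EA A
  connection : EquivariantConnection bundle
  hom : ∀ r₁ r₂ : R, 𝒢.proj (bundle.proj r₁) = 𝒢.proj (bundle.proj r₂) → 𝒢.Q
  hom_smooth : SmoothOnSubset (R.I.prod R.I) 𝒢.Q.I
    (fun z : {z : R × R | 𝒢.proj (bundle.proj z.1) = 𝒢.proj (bundle.proj z.2)} =>
      hom z.1.1 z.1.2 z.2)
  base_hom : ∀ r₁ r₂ h, 𝒢.base (hom r₁ r₂ h) = (bundle.proj r₁, bundle.proj r₂)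
  hom_act : ∀ r₁ r₂ a b h h', hom (bundle.act r₁ a) (bundle.act r₂ b) h' =
    𝒢.act (hom r₁ r₂ h) (a⁻¹ * b)
  hom_smul : ∀ (g : G) (r₁ r₂ : R) h h', hom (g • r₁) (g • r₂) h' = g • hom r₁ r₂ h
  hom_mul : ∀ r₁ r₂ r₃ h₁₂ h₂₃ h₁₃ h,
    𝒢.mul (hom r₁ r₂ h₁₂) (hom r₂ r₃ h₂₃) h = hom r₁ r₃ h₁₃
  parallel : ∀ (c₁ c₂ : ℝ → R)
    (h : ∀ t, 𝒢.proj (bundle.proj (c₁ t)) = 𝒢.proj (bundle.proj (c₂ t))),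
    ContMDiffAt 𝓘(ℝ, ℝ) R.I ∞ c₁ 0 → ContMDiffAt 𝓘(ℝ, ℝ) R.I ∞ c₂ 0 →
    𝒢.connection.along (fun t => hom (c₁ t) (c₂ t) (h t)) =
      connection.form.along c₂ - connection.form.along c₁

/-- An isomorphism of parallel trivializations: a `G`- and `A`-equivariant diffeomorphism over `Y`
preserving the connection and the isomorphism to `Q`. -/
structure ParallelTrivialization.IsIso {X : GManifold.{u₁, v₁} EG G}
    {𝒢 : Gerbe.{u₁, v₁, u₂, v₂, u₃, v₃, u₄, v₄} X EA A} {R R' : GManifold.{u, v} EG G} (T : ParallelTrivialization 𝒢 R)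
    (T' : ParallelTrivialization 𝒢 R') (φ : Diffeomorph R.I R'.I R R' ∞) : Prop where
  map_smul : ∀ (g : G) (r : R), φ (g • r) = g • φ r
  map_act : ∀ (r : R) (a : A), φ (T.bundle.act r a) = T'.bundle.act (φ r) a
  proj_map : ∀ r : R, T'.bundle.proj (φ r) = T.bundle.proj r
  hom_map : ∀ r₁ r₂ h h', T'.hom (φ r₁) (φ r₂) h' = T.hom r₁ r₂ h
  form_map : ∀ (r : R) (w : TangentSpace R.I r),
    T'.connection.form.toFun (φ r) (mfderiv R.I R'.I φ r w) = T.connection.form.toFun r w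

/-! ### Central extensions -/

variable {EB : Type*} [NormedAddCommGroup EB] [NormedSpace ℝ EB]
  {B : Type*} [TopologicalSpace B] [ChartedSpace EB B] [Group B]
  {EC : Type*} [NormedAddCommGroup EC] [NormedSpace ℝ EC]
  {C : Type*} [TopologicalSpace C] [ChartedSpace EC C] [Group C]

variable (EA EB EC) in
/-- `1 → A → B → C → 1` is a central extension of Lie groups: `α` and `β` are smooth homomorphisms,
the sequence is exact with central `α(A)`, and `β : B → C` is a smooth principal `A`-bundle
(as is automatic for finite-dimensional second countable Lie groups). -/
structure IsCentralExtension (α : A →* B) (β : B →* C) : Prop where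
  smooth_left : ContMDiff 𝓘(ℝ, EA) 𝓘(ℝ, EB) ∞ α
  smooth_right : ContMDiff 𝓘(ℝ, EB) 𝓘(ℝ, EC) ∞ β
  injective : Function.Injective α
  mem_ker : ∀ b : B, β b = 1 ↔ b ∈ Set.range α
  surjective : Function.Surjective β
  central : ∀ (a : A) (b : B), α a * b = b * α a
  principal : IsPrincipalBundle 𝓘(ℝ, EC) 𝓘(ℝ, EB) EA Set.univ β (fun b a => b * α a)

variable (EA EB EC) in
/-- An `Ad`-equivariant splitting `(s, t)`: a `B`-equivariant section `s` of `β_* : Lie B → Lie C`,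
and the corresponding retraction `t` of `α_* : Lie A → Lie B`, with `1 = α_* t + s β_*`. -/
structure AdSplitting (α : A →* B) (β : B →* C) where
  s : LieAlg EC C →L[ℝ] LieAlg EB B
  t : LieAlg EB B →L[ℝ] LieAlg EA A
  section_s : ∀ ζ, lieMap EB EC β (s ζ) = ζ
  retraction_t : ∀ η, t (lieMap EA EB α η) = η
  add_eq : ∀ ξ, lieMap EA EB α (t ξ) + s (lieMap EB EC β ξ) = ξ
  equivariant : ∀ (b : B) ζ, s (Ad EC (β b) ζ) = Ad EB b (s ζ)

/-- A `G`-equivariant central extension `ρ : R → P → X` of the `G`-equivariant principal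
`C`-bundle `π : P → X`, with total space `R`, together with a `G`-equivariant connection that is
admissible with respect to the connection `ηπ` on `π`: `β_* (η) = σ^* ηπ`. -/
@[ext]
structure AdmissibleExtension {X : GManifold.{u₁, v₁} EG G} {P : GManifold.{u₂, v₂} EG G}
    {π : EquivariantBundle X P EC C}
    (EB : Type*) [NormedAddCommGroup EB] [NormedSpace ℝ EB] [ChartedSpace EB B]
    (β : B →* C) (ηπ : EquivariantConnection π) (R : GManifold.{u, v} EG G) where
  bundle : EquivariantBundle X R EB B
  σ : R → P
  smooth_σ : ContMDiff R.I P.I ∞ σ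
  proj_σ : ∀ r, π.proj (σ r) = bundle.proj r
  σ_act : ∀ r b, σ (bundle.act r b) = π.act (σ r) (β b)
  σ_smul : ∀ (g : G) (r : R), σ (g • r) = g • σ r
  connection : EquivariantConnection bundle
  admissible : ∀ (r : R) (w : TangentSpace R.I r),
    lieMap EB EC β (connection.form.toFun r w) =
      ηπ.form.toFun (σ r) (mfderiv R.I P.I σ r w)

/-- An isomorphism of central extensions with connection: a `G`- and `B`-equivariant diffeomorphism
over `P` preserving the connection. -/
structure AdmissibleExtension.IsIso {X : GManifold.{u₁, v₁} EG G} {P : GManifold.{u₂, v₂} EG G}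
    {π : EquivariantBundle X P EC C}
    {β : B →* C} {ηπ : EquivariantConnection π} {R R' : GManifold.{u, v} EG G}
    (T : AdmissibleExtension EB β ηπ R) (T' : AdmissibleExtension EB β ηπ R')
    (φ : Diffeomorph R.I R'.I R R' ∞) : Prop where
  map_smul : ∀ (g : G) (r : R), φ (g • r) = g • φ r
  map_act : ∀ (r : R) (b : B), φ (T.bundle.act r b) = T'.bundle.act (φ r) b
  σ_map : ∀ r : R, T'.σ (φ r) = T.σ r
  form_map : ∀ (r : R) (w : TangentSpace R.I r),
    T'.connection.form.toFun (φ r) (mfderiv R.I R'.I φ r w) = T.connection.form.toFun r w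

end Equivariant


/-! ### The difference bundle of a principal bundle -/

section Transport

variable {E H : Type*} [NormedAddCommGroup E] [NormedSpace ℝ E] [TopologicalSpace H]
  (I : ModelWithCorners ℝ E H) {M N : Type*} [TopologicalSpace M] [ChartedSpace H M]
  [TopologicalSpace N] (e : N ≃ₜ M)

/-- The charted space structure transported along a homeomorphism: its charts are the compositions
of the homeomorphism with the charts of the target. -/
abbrev transportCharted : ChartedSpace H N where
  atlas := (fun c => e.toOpenPartialHomeomorph.trans c) '' atlas H M
  chartAt q := e.toOpenPartialHomeomorph.trans (chartAt H (e q))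
  mem_chart_source q := by simp
  chart_mem_atlas q := ⟨_, chart_mem_atlas H (e q), rfl⟩

theorem transport_isManifold [IsManifold I ∞ M] :
    @IsManifold ℝ _ E _ _ H _ I ∞ N _ (transportCharted e) := by
  let _ := transportCharted (H := H) e
  refine @IsManifold.mk ℝ _ E _ _ H _ I ∞ N _ _ ?_
  refine ⟨?_⟩
  rintro _ _ ⟨c, hc, rfl⟩ ⟨c', hc', rfl⟩
  have : (e.toOpenPartialHomeomorph.trans c).symm.trans (e.toOpenPartialHomeomorph.trans c') =
      c.symm.trans c' := by
    rw [OpenPartialHomeomorph.trans_symm_eq_symm_trans_symm, OpenPartialHomeomorph.trans_assoc,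
      ← OpenPartialHomeomorph.trans_assoc e.toOpenPartialHomeomorph.symm,
      ← Homeomorph.symm_toOpenPartialHomeomorph, ← Homeomorph.trans_toOpenPartialHomeomorph]
    simp
  rw [this]
  exact HasGroupoid.compatible hc hc'

theorem transport_contMDiff :
    letI := transportCharted (H := H) e
    ContMDiff I I ∞ e := by
  let _ := transportCharted (H := H) e
  intro q
  have h := (contMDiffAt_iff (I := I) (I' := I) (n := ∞) (f := (id : M → M)) (x := e q)).1
    contMDiffAt_id
  rw [contMDiffAt_iff]
  refine ⟨e.continuous.continuousAt, ?_⟩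
  convert h.2 using 1
  · ext y
    simp [extChartAt, chartAt, ChartedSpace.chartAt]
  · rfl

theorem transport_contMDiff_symm :
    letI := transportCharted (H := H) e
    ContMDiff I I ∞ e.symm := by
  let _ := transportCharted (H := H) e
  intro q
  have h := (contMDiffAt_iff (I := I) (I' := I) (n := ∞) (f := (id : M → M)) (x := q)).1
    contMDiffAt_id
  rw [contMDiffAt_iff]
  refine ⟨e.symm.continuous.continuousAt, ?_⟩
  convert h.2 using 1
  · ext y
    simp [extChartAt, chartAt, ChartedSpace.chartAt]

end Transport

/-! ### The Maurer-Cartan form -/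

section MaurerCartan

variable {EB : Type*} [NormedAddCommGroup EB] [NormedSpace ℝ EB]
  {B : Type*} [TopologicalSpace B] [ChartedSpace EB B] [Group B]

theorem maurerCartan_one_apply (ξ : LieAlg EB B) (b : B) (hb : b = 1) :
    @Eq EB (maurerCartan EB b ξ) ξ := by
  subst hb
  have h : (fun x : B => (1 : B)⁻¹ * x) = id := by
    funext x; simp
  refine (congrArg (fun T : EB →L[ℝ] EB => T ξ) (mfderiv_congr (I := 𝓘(ℝ, EB))
    (I' := 𝓘(ℝ, EB)) (x := (1 : B)) h)).trans ?_
  exact congrArg (fun T : EB →L[ℝ] EB => T ξ) (mfderiv_id (I := 𝓘(ℝ, EB)) (x := (1 : B)))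

theorem maurerCartan_const {E' H' : Type*} [NormedAddCommGroup E'] [NormedSpace ℝ E']
    [TopologicalSpace H'] {I' : ModelWithCorners ℝ E' H'} {N : Type*} [TopologicalSpace N]
    [ChartedSpace H' N] (x : N) (b : B) (w : TangentSpace I' x) :
    @Eq EB (maurerCartan EB b (mfderiv I' 𝓘(ℝ, EB) (fun _ : N => b) x w)) 0 := by
  have h : @Eq EB (mfderiv I' 𝓘(ℝ, EB) (fun _ : N => b) x w) 0 :=
    congrArg (fun T : E' →L[ℝ] EB => T w) mfderiv_const
  exact (congrArg (fun ξ : EB => maurerCartan EB b ξ) h).trans (map_zero _)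

variable [LieGroup 𝓘(ℝ, EB) ∞ B]

theorem maurerCartan_smooth :
    ContMDiff (M' := EB) 𝓘(ℝ, EB).tangent 𝓘(ℝ, EB) ∞
      (fun w : TangentBundle 𝓘(ℝ, EB) B => maurerCartan EB w.1 w.2) := by
  have S₀ : ContMDiff 𝓘(ℝ, EB).tangent 𝓘(ℝ, EB).tangent ∞
      (fun w : TangentBundle 𝓘(ℝ, EB) B =>
        (Bundle.TotalSpace.mk' EB w.1⁻¹ 0 : TangentBundle 𝓘(ℝ, EB) B)) :=
    (Bundle.contMDiff_zeroSection ℝ (TangentSpace 𝓘(ℝ, EB) : B → Type _)).comp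
      ((contMDiff_inv 𝓘(ℝ, EB) ∞).comp (Bundle.contMDiff_proj _))
  have S₁ := S₀.prodMk contMDiff_id
  have S₂ := (contMDiff_equivTangentBundleProd_symm (I := 𝓘(ℝ, EB)) (M := B) (I' := 𝓘(ℝ, EB))
    (M' := B) (n := ∞)).comp S₁
  have S₃ := (ContMDiff.contMDiff_tangentMap (m := ∞)
    (contMDiff_mul (G := B) 𝓘(ℝ, EB) ∞) le_rfl).comp S₂
  have key : ∀ (b : B) (_ : b = 1) (x : EB),
      (Bundle.TotalSpace.mk' EB b x : TangentBundle 𝓘(ℝ, EB) B) =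
        Bundle.TotalSpace.mk' EB (1 : B) x := by
    rintro _ rfl _; rfl
  have S₄ : ContMDiff 𝓘(ℝ, EB).tangent 𝓘(ℝ, EB).tangent ∞
      (fun w : TangentBundle 𝓘(ℝ, EB) B =>
        (Bundle.TotalSpace.mk' EB (1 : B) (maurerCartan EB w.1 w.2) :
          TangentBundle 𝓘(ℝ, EB) B)) := by
    refine S₃.congr fun w => ?_
    refine (key (w.1⁻¹ * w.1) (inv_mul_cancel _) _).symm.trans ?_
    refine congrArg (fun x : EB =>
      (Bundle.TotalSpace.mk' EB (w.1⁻¹ * w.1) x : TangentBundle 𝓘(ℝ, EB) B)) ?_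
    have h := mfderiv_prod_eq_add_apply (I := 𝓘(ℝ, EB)) (I' := 𝓘(ℝ, EB)) (I'' := 𝓘(ℝ, EB))
      (f := fun p : B × B => p.1 * p.2) (p := (w.1⁻¹, w.1)) (v := ((0 : EB), w.2))
      ((contMDiff_mul (G := B) 𝓘(ℝ, EB) ∞).mdifferentiable (by simp) _)
    refine Eq.trans ?_ h.symm
    refine Eq.trans (zero_add _).symm ?_
    refine congrArg₂ (· + ·) ?_ rfl
    exact (map_zero (mfderiv 𝓘(ℝ, EB) 𝓘(ℝ, EB) (fun z : B => z * w.1) w.1⁻¹)).symm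
  intro w
  have h := (Bundle.contMDiffAt_totalSpace.1 (S₄ w)).2
  refine h.congr_of_eventuallyEq (Filter.Eventually.of_forall fun w' => ?_)
  exact ((tangentBundleCore 𝓘(ℝ, EB) B).coordChange_self (achart EB (1 : B)) 1
    (mem_achart_source EB (1 : B)) _).symm

/-- The product rule for the Maurer-Cartan form. -/
theorem maurerCartan_mul {E' H' : Type*} [NormedAddCommGroup E'] [NormedSpace ℝ E']
    [TopologicalSpace H'] {I' : ModelWithCorners ℝ E' H'} {N : Type*} [TopologicalSpace N]
    [ChartedSpace H' N] {f g : N → B} {x : N} (hf : MDifferentiableAt I' 𝓘(ℝ, EB) f x)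
    (hg : MDifferentiableAt I' 𝓘(ℝ, EB) g x) (w : TangentSpace I' x) :
    maurerCartan EB (f x * g x) (mfderiv I' 𝓘(ℝ, EB) (fun y => f y * g y) x w) =
      Ad EB (g x)⁻¹ (maurerCartan EB (f x) (mfderiv I' 𝓘(ℝ, EB) f x w)) +
        maurerCartan EB (g x) (mfderiv I' 𝓘(ℝ, EB) g x w) := by
  have hmul : ∀ p : B × B, MDifferentiableAt (𝓘(ℝ, EB).prod 𝓘(ℝ, EB)) 𝓘(ℝ, EB)
      (fun p : B × B => p.1 * p.2) p :=
    (contMDiff_mul (G := B) 𝓘(ℝ, EB) ∞).mdifferentiable (by simp)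
  have hl : ∀ a b : B, MDifferentiableAt 𝓘(ℝ, EB) 𝓘(ℝ, EB) (fun z : B => a * z) b :=
    fun a b => (contMDiff_mul_left (n := ∞)).mdifferentiable (by simp) b
  have hr : ∀ a b : B, MDifferentiableAt 𝓘(ℝ, EB) 𝓘(ℝ, EB) (fun z : B => z * a) b :=
    fun a b => (contMDiff_mul_right (n := ∞)).mdifferentiable (by simp) b
  -- the derivative of the product
  have h₁ : @Eq EB (mfderiv I' 𝓘(ℝ, EB) (fun y => f y * g y) x w)
      ((mfderiv 𝓘(ℝ, EB) 𝓘(ℝ, EB) (fun z : B => z * g x) (f x) (mfderiv I' 𝓘(ℝ, EB) f x w) : EB) +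
        (mfderiv 𝓘(ℝ, EB) 𝓘(ℝ, EB) (fun z : B => f x * z) (g x)
          (mfderiv I' 𝓘(ℝ, EB) g x w) : EB)) := by
    have h := mfderiv_comp_apply (I := I') (I' := 𝓘(ℝ, EB).prod 𝓘(ℝ, EB)) (I'' := 𝓘(ℝ, EB))
      x (g := fun p : B × B => p.1 * p.2) (f := fun y => (f y, g y)) (hmul _) (hf.prodMk hg) w
    refine Eq.trans h ?_
    refine Eq.trans (mfderiv_prod_eq_add_apply (hmul (f x, g x))) ?_
    have h' := mfderiv_prodMk hf hg
    refine congrArg (fun T : E' →L[ℝ] EB × EB =>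
      (mfderiv 𝓘(ℝ, EB) 𝓘(ℝ, EB) (fun z : B => z * g x) (f x) (T w).1 : EB) +
        (mfderiv 𝓘(ℝ, EB) 𝓘(ℝ, EB) (fun z : B => f x * z) (g x) (T w).2 : EB)) h'
  have h₂ : ∀ ξ : EB, @Eq EB (maurerCartan EB (f x * g x)
      (mfderiv 𝓘(ℝ, EB) 𝓘(ℝ, EB) (fun z : B => f x * z) (g x) ξ))
      (maurerCartan EB (g x) ξ) := by
    intro ξ
    have h := mfderiv_comp_apply (I := 𝓘(ℝ, EB)) (I' := 𝓘(ℝ, EB)) (I'' := 𝓘(ℝ, EB))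
      (g x) (g := fun z : B => (f x * g x)⁻¹ * z) (f := fun z : B => f x * z) (hl _ _) (hl _ _) ξ
    refine Eq.trans h.symm ?_
    refine congrArg (fun T : EB →L[ℝ] EB => T ξ) (mfderiv_congr ?_)
    funext z
    simp [mul_assoc]
  have h₃ : ∀ ξ : EB, @Eq EB (maurerCartan EB (f x * g x)
      (mfderiv 𝓘(ℝ, EB) 𝓘(ℝ, EB) (fun z : B => z * g x) (f x) ξ))
      (Ad EB (g x)⁻¹ (maurerCartan EB (f x) ξ)) := by
    intro ξ
    have h := mfderiv_comp_apply (I := 𝓘(ℝ, EB)) (I' := 𝓘(ℝ, EB)) (I'' := 𝓘(ℝ, EB))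
      (f x) (g := fun z : B => (f x * g x)⁻¹ * z) (f := fun z : B => z * g x) (hl _ _) (hr _ _) ξ
    have hc : MDifferentiableAt 𝓘(ℝ, EB) 𝓘(ℝ, EB)
        (fun z : B => (g x)⁻¹ * z * (g x)⁻¹⁻¹) ((f x)⁻¹ * f x) :=
      ((contMDiff_mul_right (n := ∞)).comp (contMDiff_mul_left (n := ∞))).mdifferentiable
        (by simp) _
    have h' := mfderiv_comp_apply (I := 𝓘(ℝ, EB)) (I' := 𝓘(ℝ, EB)) (I'' := 𝓘(ℝ, EB))
      (f x) (g := fun z : B => (g x)⁻¹ * z * (g x)⁻¹⁻¹) (f := fun z : B => (f x)⁻¹ * z)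
      hc (hl _ _) ξ
    refine Eq.trans h.symm ?_
    refine Eq.trans ?_ (Eq.trans h' ?_)
    · refine congrArg (fun T : EB →L[ℝ] EB => T ξ) (mfderiv_congr ?_)
      funext z
      simp [mul_assoc]
    · exact congrArg (fun T : EB →L[ℝ] EB => T (maurerCartan EB (f x) ξ))
        (mfderiv_congr_point (inv_mul_cancel (f x)))
  refine Eq.trans (congrArg (fun ξ : EB => maurerCartan EB (f x * g x) ξ) h₁) ?_
  refine Eq.trans (map_add (maurerCartan EB (f x * g x)) _ _) ?_
  exact congrArg₂ (fun a b : EB => a + b) (h₃ _) (h₂ _)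

end MaurerCartan

section DifferenceBundle

variable {EG : Type*} [NormedAddCommGroup EG] [NormedSpace ℝ EG]
  {G : Type*} [TopologicalSpace G] [ChartedSpace EG G] [Group G]
  {EA : Type*} [NormedAddCommGroup EA] [NormedSpace ℝ EA]
  {A : Type*} [TopologicalSpace A] [ChartedSpace EA A] [CommGroup A]
  {EB : Type*} [NormedAddCommGroup EB] [NormedSpace ℝ EB]
  {B : Type*} [TopologicalSpace B] [ChartedSpace EB B] [Group B]
  {EC : Type*} [NormedAddCommGroup EC] [NormedSpace ℝ EC]
  {C : Type*} [TopologicalSpace C] [ChartedSpace EC C] [Group C]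
  {X : GManifold.{u₁, v₁} EG G} {P : GManifold.{u₂, v₂} EG G}
  {α : A →* B} {β : B →* C} (π : EquivariantBundle X P EC C)

/-- The underlying space of the difference bundle: the triples `(p₁, p₂, b)` with
`p₁ · β b = p₂`, that is, with `p₁, p₂` in the same fibre and `δ(p₁, p₂) = β b`. This is the
pullback of `β : B → C` along the difference map `δ : P ×_X P → C`. -/
@[ext]
structure DiffSpace (β : B →* C) (π : EquivariantBundle X P EC C) where
  fst : P
  snd : P
  grp : B
  eq : π.act fst (β grp) = snd

/-- The subspace topology from `P × P × B`. -/
instance : TopologicalSpace (DiffSpace β π) :=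
  TopologicalSpace.induced (fun z => (z.fst, z.snd, z.grp)) inferInstance

variable {π}

theorem EquivariantBundle.smooth_act (π : EquivariantBundle X P EC C) :
    ContMDiff (P.I.prod 𝓘(ℝ, EC)) P.I ∞ (fun z : P × C => π.act z.1 z.2) :=
  π.principal.smooth_act

/-- The difference bundle is homeomorphic to `P × B` by `(p₁, p₂, b) ↦ (p₁, b)`. -/
def diffHomeo (hβ : ContMDiff 𝓘(ℝ, EB) 𝓘(ℝ, EC) ∞ β) (π : EquivariantBundle X P EC C) :
    DiffSpace β π ≃ₜ P × B where
  toFun z := (z.fst, z.grp)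
  invFun z := ⟨z.1, π.act z.1 (β z.2), z.2, rfl⟩
  left_inv z := DiffSpace.ext rfl z.eq rfl
  right_inv _ := rfl
  continuous_toFun := by
    have h : Continuous (fun z : DiffSpace β π => (z.fst, z.snd, z.grp)) :=
      continuous_induced_dom
    exact h.fst.prodMk h.snd.snd
  continuous_invFun := by
    refine continuous_induced_rng.2 (continuous_fst.prodMk (Continuous.prodMk ?_ continuous_snd))
    exact π.smooth_act.continuous.comp
      (continuous_fst.prodMk (hβ.continuous.comp continuous_snd))

theorem AdSplitting.t_s (S : AdSplitting EA EB EC α β) (ζ : LieAlg EC C) : S.t (S.s ζ) = 0 := by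
  have h := congrArg S.t (S.add_eq (S.s ζ))
  rw [map_add, S.retraction_t, S.section_s] at h
  exact left_eq_add.1 h.symm

variable [LieGroup 𝓘(ℝ, EB) ∞ B]

/-- The difference bundle as a smooth manifold, diffeomorphic to `P × B` by
`(p₁, p₂, b) ↦ (p₁, b)`. -/
def diffSmoothManifold (hβ : ContMDiff 𝓘(ℝ, EB) 𝓘(ℝ, EC) ∞ β)
    (π : EquivariantBundle X P EC C) : SmoothManifold where
  carrier := DiffSpace β π
  E := P.E × EB
  H := ModelProd P.H EB
  I := P.I.prod 𝓘(ℝ, EB)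
  charted := transportCharted (diffHomeo hβ π)
  smooth := transport_isManifold (P.I.prod 𝓘(ℝ, EB)) (diffHomeo hβ π)

section

variable (hβ : ContMDiff 𝓘(ℝ, EB) 𝓘(ℝ, EC) ∞ β)

theorem diff_smooth_homeo : ContMDiff (diffSmoothManifold hβ π).I (P.I.prod 𝓘(ℝ, EB)) ∞
    (fun z : diffSmoothManifold hβ π => diffHomeo hβ π z) :=
  transport_contMDiff (P.I.prod 𝓘(ℝ, EB)) (diffHomeo hβ π)

theorem diff_smooth_homeo_symm : ContMDiff (M' := diffSmoothManifold hβ π) (P.I.prod 𝓘(ℝ, EB)) (diffSmoothManifold hβ π).I ∞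
    (fun z : P × B => (diffHomeo hβ π).symm z) :=
  transport_contMDiff_symm (P.I.prod 𝓘(ℝ, EB)) (diffHomeo hβ π)

theorem diffAux_smooth_fst :
    ContMDiff (diffSmoothManifold hβ π).I P.I ∞
      (fun z : diffSmoothManifold hβ π => DiffSpace.fst z) :=
  contMDiff_fst.comp (diff_smooth_homeo hβ)

theorem diffAux_smooth_grp :
    ContMDiff (diffSmoothManifold hβ π).I 𝓘(ℝ, EB) ∞
      (fun z : diffSmoothManifold hβ π => DiffSpace.grp z) :=
  contMDiff_snd.comp (diff_smooth_homeo hβ)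

theorem diffAux_smooth_snd :
    ContMDiff (diffSmoothManifold hβ π).I P.I ∞
      (fun z : diffSmoothManifold hβ π => DiffSpace.snd z) := by
  have h := π.smooth_act.comp ((diffAux_smooth_fst (π := π) hβ).prodMk
    (hβ.comp (diffAux_smooth_grp (π := π) hβ)))
  refine h.congr fun z => ?_
  exact (DiffSpace.eq z).symm

theorem diffAux_contMDiffOn {E' H' : Type*} [NormedAddCommGroup E'] [NormedSpace ℝ E']
    [TopologicalSpace H'] {I' : ModelWithCorners ℝ E' H'} {N : Type*} [TopologicalSpace N]
    [ChartedSpace H' N] {f : N → diffSmoothManifold hβ π} {U : Set N}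
    (h₁ : ContMDiffOn I' P.I ∞ (fun n => DiffSpace.fst (f n)) U)
    (h₂ : ContMDiffOn I' 𝓘(ℝ, EB) ∞ (fun n => DiffSpace.grp (f n)) U) :
    ContMDiffOn I' (diffSmoothManifold hβ π).I ∞ f U := by
  have h := (diff_smooth_homeo_symm (π := π) hβ).comp_contMDiffOn
    (h₁.prodMk h₂)
  refine h.congr fun n _ => ?_
  exact ((diffHomeo hβ π).symm_apply_apply (f n)).symm

theorem diffAux_contMDiff {E' H' : Type*} [NormedAddCommGroup E'] [NormedSpace ℝ E']
    [TopologicalSpace H'] {I' : ModelWithCorners ℝ E' H'} {N : Type*} [TopologicalSpace N]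
    [ChartedSpace H' N] {f : N → diffSmoothManifold hβ π}
    (h₁ : ContMDiff I' P.I ∞ (fun n => DiffSpace.fst (f n)))
    (h₂ : ContMDiff I' 𝓘(ℝ, EB) ∞ (fun n => DiffSpace.grp (f n))) :
    ContMDiff I' (diffSmoothManifold hβ π).I ∞ f :=
  contMDiffOn_univ.1 (diffAux_contMDiffOn hβ h₁.contMDiffOn h₂.contMDiffOn)

/-- The action `g (p₁, p₂, b) = (g p₁, g p₂, b)` of `G` on the difference bundle. -/
instance : MulAction G (DiffSpace β π) where
  smul g z := ⟨g • z.fst, g • z.snd, z.grp, by rw [π.act_smul, z.eq]⟩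
  one_smul z := DiffSpace.ext (one_smul _ _) (one_smul _ _) rfl
  mul_smul g h z := DiffSpace.ext (mul_smul _ _ _) (mul_smul _ _ _) rfl

/-- The difference bundle with the action `g (p₁, p₂, b) = (g p₁, g p₂, b)` of `G`. -/
def diffManifold (hβ : ContMDiff 𝓘(ℝ, EB) 𝓘(ℝ, EC) ∞ β)
    (π : EquivariantBundle X P EC C) : GManifold EG G where
  toSmoothManifold := diffSmoothManifold hβ π
  action := inferInstanceAs (MulAction G (DiffSpace β π))
  smoothAction := by
    let _ : MulAction G (diffSmoothManifold hβ π) := inferInstanceAs (MulAction G (DiffSpace β π))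
    refine ⟨diffAux_contMDiff hβ ?_ ?_⟩
    · exact (contMDiff_smul (I := 𝓘(ℝ, EG)) (I' := P.I) (n := ∞) (G := G) (M := P)).comp
        (contMDiff_fst.prodMk ((diffAux_smooth_fst hβ).comp contMDiff_snd))
    · have h : ContMDiff (𝓘(ℝ, EG).prod (diffSmoothManifold hβ π).I) 𝓘(ℝ, EB) ∞
          (fun n : G × diffSmoothManifold hβ π => DiffSpace.grp n.2) :=
        (diffAux_smooth_grp hβ).comp contMDiff_snd
      exact h

theorem diff_smooth_fst : ContMDiff (diffManifold hβ π).I P.I ∞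
    (fun z : diffManifold hβ π => DiffSpace.fst z) :=
  diffAux_smooth_fst hβ

theorem diff_smooth_snd : ContMDiff (diffManifold hβ π).I P.I ∞
    (fun z : diffManifold hβ π => DiffSpace.snd z) :=
  diffAux_smooth_snd hβ

theorem diff_smooth_grp : ContMDiff (diffManifold hβ π).I 𝓘(ℝ, EB) ∞
    (fun z : diffManifold hβ π => DiffSpace.grp z) :=
  diffAux_smooth_grp hβ

theorem diff_contMDiffOn {E' H' : Type*} [NormedAddCommGroup E'] [NormedSpace ℝ E']
    [TopologicalSpace H'] {I' : ModelWithCorners ℝ E' H'} {N : Type*} [TopologicalSpace N]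
    [ChartedSpace H' N] {f : N → diffManifold hβ π} {U : Set N}
    (h₁ : ContMDiffOn I' P.I ∞ (fun n => DiffSpace.fst (f n)) U)
    (h₂ : ContMDiffOn I' 𝓘(ℝ, EB) ∞ (fun n => DiffSpace.grp (f n)) U) :
    ContMDiffOn I' (diffManifold hβ π).I ∞ f U :=
  diffAux_contMDiffOn hβ h₁ h₂

theorem diff_contMDiff {E' H' : Type*} [NormedAddCommGroup E'] [NormedSpace ℝ E']
    [TopologicalSpace H'] {I' : ModelWithCorners ℝ E' H'} {N : Type*} [TopologicalSpace N]
    [ChartedSpace H' N] {f : N → diffManifold hβ π}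
    (h₁ : ContMDiff I' P.I ∞ (fun n => DiffSpace.fst (f n)))
    (h₂ : ContMDiff I' 𝓘(ℝ, EB) ∞ (fun n => DiffSpace.grp (f n))) :
    ContMDiff I' (diffManifold hβ π).I ∞ f :=
  diffAux_contMDiff hβ h₁ h₂

end

/-- The action `(p₁, p₂, b) a = (p₁, p₂, b α(a))` of `A` on the difference bundle. -/
def DiffSpace.act (hext : IsCentralExtension EA EB EC α β) (z : DiffSpace β π) (a : A) :
    DiffSpace β π :=
  ⟨z.fst, z.snd, z.grp * α a, by
    rw [map_mul, (hext.mem_ker _).2 ⟨a, rfl⟩, mul_one, z.eq]⟩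

/-- The action of `A` on the difference bundle, as a manifold. -/
def diffAct (hext : IsCentralExtension EA EB EC α β) (z : diffManifold hext.smooth_right π)
    (a : A) : diffManifold hext.smooth_right π :=
  DiffSpace.act hext z a

/-- The principal `A`-bundle structure of the difference bundle. -/
theorem diff_principal [LieGroup 𝓘(ℝ, EA) ∞ A] [LieGroup 𝓘(ℝ, EC) ∞ C]
    (hext : IsCentralExtension EA EB EC α β) :
    IsPrincipalBundle (P.I.prod P.I) (diffManifold hext.smooth_right π).I EA
      {z : P × P | π.proj z.1 = π.proj z.2}
      (fun z : diffManifold hext.smooth_right π => (DiffSpace.fst z, DiffSpace.snd z))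
      (diffAct hext) where
  smooth_proj := (diff_smooth_fst _).prodMk (diff_smooth_snd _)
  proj_mem z := by
    have h := DiffSpace.eq z
    change π.proj (DiffSpace.fst z) = π.proj (DiffSpace.snd z)
    rw [← h, π.principal.proj_act]
  smooth_act := by
    refine diff_contMDiff _ ?_ ?_
    · have h : ContMDiff ((diffManifold hext.smooth_right π).I.prod 𝓘(ℝ, EA)) P.I ∞
          (fun n : diffManifold hext.smooth_right π × A => DiffSpace.fst n.1) :=
        (diff_smooth_fst _).comp contMDiff_fst
      exact h
    · have h : ContMDiff ((diffManifold hext.smooth_right π).I.prod 𝓘(ℝ, EA)) 𝓘(ℝ, EB) ∞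
          (fun n : diffManifold hext.smooth_right π × A => DiffSpace.grp n.1 * α n.2) :=
        ((diff_smooth_grp _).comp contMDiff_fst).mul (hext.smooth_left.comp contMDiff_snd)
      exact h
  act_one z := DiffSpace.ext rfl rfl (by simp [diffAct, DiffSpace.act])
  act_mul z a b := DiffSpace.ext rfl rfl (by simp [diffAct, DiffSpace.act, mul_assoc])
  proj_act _ _ := rfl
  locTriv := by
    rintro ⟨p, p'⟩ (hp : π.proj p = π.proj p')
    obtain ⟨V, s₀, h₀, hV, hpV, -, hh₀, hs₀', hsh₀⟩ :=
      π.principal.locTriv (π.proj p) (Set.mem_univ _)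
    -- the difference map near `(p, p')`
    let d : P × P → C := fun z => (h₀ z.1)⁻¹ * h₀ z.2
    obtain ⟨W, s, h, hW, hdW, hs, hh, hs', hsh⟩ :=
      hext.principal.locTriv (d (p, p')) (Set.mem_univ _)
    let O : Set (P × P) := (π.proj ⁻¹' V) ×ˢ (π.proj ⁻¹' V)
    have hVo : IsOpen (π.proj ⁻¹' V) := hV.preimage π.principal.smooth_proj.continuous
    have hO : IsOpen O := hVo.prod hVo
    have hd : ContMDiffOn (P.I.prod P.I) 𝓘(ℝ, EC) ∞ d O :=
      ContMDiffOn.mul (I := 𝓘(ℝ, EC)) (ContMDiffOn.inv (I := 𝓘(ℝ, EC)) (hh₀.comp contMDiffOn_fst fun z hz => hz.1))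
        (hh₀.comp contMDiffOn_snd fun z hz => hz.2)
    have hU : IsOpen (O ∩ d ⁻¹' W) := hd.continuousOn.isOpen_inter_preimage hO hW
    have hact : ∀ q ∈ π.proj ⁻¹' V, ∀ c, h₀ (π.act q c) = h₀ q * c := by
      intro q hq c
      have h1 := hsh₀ q hq
      conv_lhs => rw [← h1, ← π.principal.act_mul]
      exact (hs₀' _ ⟨Set.mem_univ _, hq⟩).2 _
    have hdiff : ∀ z ∈ O, π.proj z.1 = π.proj z.2 → π.act z.1 (d z) = z.2 := by
      intro z hz hzz
      have h1 := hsh₀ z.1 hz.1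
      have h2 := hsh₀ z.2 hz.2
      rw [← h1, ← π.principal.act_mul]
      simp only [d, mul_inv_cancel_left]
      rw [hzz]; exact h2
    have hdq : ∀ z ∈ O, ∀ b : B, π.act z.1 (β b) = z.2 → d z = β b := by
      intro z hz b hb
      simp only [d]
      rw [← hb, hact _ hz.1, inv_mul_cancel_left]
    refine ⟨O ∩ d ⁻¹' W,
      fun z => (⟨z.1, π.act z.1 (β (s (d z))), s (d z), rfl⟩ : DiffSpace β π),
      fun q => h (DiffSpace.grp q), hU,
      ⟨⟨hpV, by simpa [← hp] using hpV⟩, hdW⟩, ?_, ?_, ?_, ?_⟩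
    · refine diff_contMDiffOn _ contMDiffOn_fst ?_
      exact hs.comp (hd.mono Set.inter_subset_left) fun z hz => hz.2
    · refine hh.comp (diff_smooth_grp hext.smooth_right).contMDiffOn ?_
      rintro q ⟨hqO, hqW⟩
      have := hdq _ hqO _ (DiffSpace.eq q)
      change β (DiffSpace.grp q) ∈ W
      rw [← this]; exact hqW
    · rintro z ⟨hz, hzO, hzW⟩
      have hb := (hs' (d z) ⟨Set.mem_univ _, hzW⟩)
      refine ⟨?_, hb.2⟩
      change (z.1, π.act z.1 (β (s (d z)))) = z
      rw [hb.1, hdiff z hzO hz]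
    · rintro q ⟨hqO, hqW⟩
      have hq := hdq _ hqO _ (DiffSpace.eq q)
      have hqW' : β (DiffSpace.grp q) ∈ W := by rw [← hq]; exact hqW
      have hbb := (hs' _ ⟨Set.mem_univ _, hqW⟩).1
      refine DiffSpace.ext rfl ?_ ?_
      · change π.act (DiffSpace.fst q) (β (s (d (DiffSpace.fst q, DiffSpace.snd q)))) = _
        rw [hbb, hq]; exact DiffSpace.eq q
      · change s (d (DiffSpace.fst q, DiffSpace.snd q)) * α (h (DiffSpace.grp q)) = _
        rw [hq]; exact hsh _ hqW'

section Splitting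

variable (S : AdSplitting EA EB EC α β)

theorem lieMap_Ad [LieGroup 𝓘(ℝ, EC) ∞ C] (hβ : ContMDiff 𝓘(ℝ, EB) 𝓘(ℝ, EC) ∞ β) (b : B)
    (ξ : LieAlg EB B) :
    lieMap EB EC β (Ad EB b ξ) = Ad EC (β b) (lieMap EB EC β ξ) := by
  have hβ' : ∀ x, MDifferentiableAt 𝓘(ℝ, EB) 𝓘(ℝ, EC) β x :=
    hβ.mdifferentiable (by simp)
  have h₁ := mfderiv_comp_apply (I := 𝓘(ℝ, EB)) (I' := 𝓘(ℝ, EB)) (I'' := 𝓘(ℝ, EC))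
    (1 : B) (g := β) (f := fun x : B => b * x * b⁻¹) (hβ' _)
    (((contMDiff_mul_right (n := ∞)).comp (contMDiff_mul_left (n := ∞))).mdifferentiable
      (by simp) _) ξ
  have h₂ := mfderiv_comp_apply (I := 𝓘(ℝ, EB)) (I' := 𝓘(ℝ, EC)) (I'' := 𝓘(ℝ, EC))
    (1 : B) (g := fun x : C => β b * x * (β b)⁻¹) (f := β)
    (((contMDiff_mul_right (n := ∞)).comp (contMDiff_mul_left (n := ∞))).mdifferentiable
      (by simp) _) (hβ' _) ξ
  have h₃ : (β : B → C) ∘ (fun x : B => b * x * b⁻¹) =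
      (fun x : C => β b * x * (β b)⁻¹) ∘ β := by
    funext x; simp
  have e₁ : @Eq EC (lieMap EB EC β (Ad EB b ξ))
      (mfderiv 𝓘(ℝ, EB) 𝓘(ℝ, EC) β (b * 1 * b⁻¹)
        (mfderiv 𝓘(ℝ, EB) 𝓘(ℝ, EB) (fun x : B => b * x * b⁻¹) 1 ξ)) :=
    congrArg (fun T : EB →L[ℝ] EC => T (Ad EB b ξ)) (mfderiv_congr_point (by simp))
  have e₂ : @Eq EC (Ad EC (β b) (lieMap EB EC β ξ))
      (mfderiv 𝓘(ℝ, EC) 𝓘(ℝ, EC) (fun x : C => β b * x * (β b)⁻¹) (β 1)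
        (mfderiv 𝓘(ℝ, EB) 𝓘(ℝ, EC) β 1 ξ)) :=
    congrArg (fun T : EC →L[ℝ] EC => T (lieMap EB EC β ξ)) (mfderiv_congr_point (by simp))
  refine e₁.trans (Eq.trans h₁.symm (Eq.trans ?_ (h₂.trans e₂.symm)))
  exact congrArg (fun T : EB →L[ℝ] EC => T ξ) (mfderiv_congr h₃)

theorem Ad_lieMap (hext : IsCentralExtension EA EB EC α β) (b : B) (η : LieAlg EA A) :
    Ad EB b (lieMap EA EB α η) = lieMap EA EB α η := by
  have h := mfderiv_comp_apply (I := 𝓘(ℝ, EA)) (I' := 𝓘(ℝ, EB)) (I'' := 𝓘(ℝ, EB))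
    (1 : A) (g := fun x : B => b * x * b⁻¹) (f := α)
    (((contMDiff_mul_right (n := ∞)).comp (contMDiff_mul_left (n := ∞))).mdifferentiable
      (by simp) _) (hext.smooth_left.mdifferentiable (by simp) _) η
  have h' : (fun x : B => b * x * b⁻¹) ∘ α = α := by
    funext x
    simp [← hext.central x b]
  have e : @Eq EB (Ad EB b (lieMap EA EB α η))
      (mfderiv 𝓘(ℝ, EB) 𝓘(ℝ, EB) (fun x : B => b * x * b⁻¹) (α 1)
        (mfderiv 𝓘(ℝ, EA) 𝓘(ℝ, EB) α 1 η)) :=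
    congrArg (fun T : EB →L[ℝ] EB => T (lieMap EA EB α η)) (mfderiv_congr_point (by simp))
  refine e.trans (Eq.trans h.symm ?_)
  exact congrArg (fun T : EA →L[ℝ] EB => T η) (mfderiv_congr h')

theorem AdSplitting.t_Ad [LieGroup 𝓘(ℝ, EC) ∞ C] (hext : IsCentralExtension EA EB EC α β)
    (b : B) (ξ : LieAlg EB B) : S.t (Ad EB b ξ) = S.t ξ := by
  conv_lhs => rw [← S.add_eq ξ]
  rw [map_add, map_add, Ad_lieMap hext, S.retraction_t, ← S.equivariant, S.t_s, add_zero]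

theorem Ad_comm [LieGroup 𝓘(ℝ, EA) ∞ A] (a : A) (η : LieAlg EA A) : Ad EA a η = η := by
  have h : (fun x : A => a * x * a⁻¹) = id := by
    funext x; simp [mul_comm a x]
  refine (congrArg (fun T : EA →L[ℝ] EA => T η) (mfderiv_congr (I := 𝓘(ℝ, EA))
    (I' := 𝓘(ℝ, EA)) (x := (1 : A)) h)).trans ?_
  exact congrArg (fun T : EA →L[ℝ] EA => T η) (mfderiv_id (I := 𝓘(ℝ, EA)) (x := (1 : A)))

end Splitting

/-- The connection on the difference bundle: the pullback along `(p₁, p₂, b) ↦ b` of the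
connection on `β : B → C` given by the splitting, `ξ ↦ t (b⁻¹ ξ)` for `ξ ∈ T_b B`. -/
def diffForm (hβ : ContMDiff 𝓘(ℝ, EB) 𝓘(ℝ, EC) ∞ β) (S : AdSplitting EA EB EC α β)
    (π : EquivariantBundle X P EC C) : OneForm (diffManifold hβ π).toSmoothManifold EA A where
  toFun z := S.t.comp ((maurerCartan EB (DiffSpace.grp z)).comp
    (mfderiv (diffManifold hβ π).I 𝓘(ℝ, EB)
      (fun z : diffManifold hβ π => DiffSpace.grp z) z))
  smooth := by
    have h₁ := maurerCartan_smooth.comp (ContMDiff.contMDiff_tangentMap (m := ∞)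
      (diff_smooth_grp (π := π) hβ) le_rfl)
    have h₂ : ContMDiff (M := EB) (M' := EA) 𝓘(ℝ, EB) 𝓘(ℝ, EA) ∞ S.t :=
      ContinuousLinearMap.contMDiff (E := EB) (F := EA) S.t
    exact h₂.comp h₁

/-- Evaluation of the connection on the difference bundle on a derivative. -/
theorem diffForm_mfderiv (hβ : ContMDiff 𝓘(ℝ, EB) 𝓘(ℝ, EC) ∞ β) (S : AdSplitting EA EB EC α β)
    {E' H' : Type*} [NormedAddCommGroup E'] [NormedSpace ℝ E']
    [TopologicalSpace H'] {I' : ModelWithCorners ℝ E' H'} {N : Type*} [TopologicalSpace N]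
    [ChartedSpace H' N] {f : N → diffManifold hβ π} {x : N}
    (hf : MDifferentiableAt I' (diffManifold hβ π).I f x) (w : TangentSpace I' x) :
    (diffForm hβ S π).toFun (f x) (mfderiv I' (diffManifold hβ π).I f x w) =
      S.t (maurerCartan EB (DiffSpace.grp (f x))
        (mfderiv I' 𝓘(ℝ, EB) (fun n => DiffSpace.grp (f n)) x w)) := by
  have h := mfderiv_comp_apply (I := I') (I' := (diffManifold hβ π).I) (I'' := 𝓘(ℝ, EB)) x
    (g := fun z : diffManifold hβ π => DiffSpace.grp z) (f := f)
    ((diff_smooth_grp hβ).mdifferentiable (by simp) _) hf w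
  exact congrArg (fun ξ : EB => S.t (maurerCartan EB (DiffSpace.grp (f x)) ξ)) h.symm

theorem diffForm_isConnection [LieGroup 𝓘(ℝ, EA) ∞ A] [LieGroup 𝓘(ℝ, EC) ∞ C]
    (hext : IsCentralExtension EA EB EC α β) (S : AdSplitting EA EB EC α β) :
    IsConnectionForm (M := (diffManifold hext.smooth_right π).toSmoothManifold) EA
      (diffAct hext) (diffForm hext.smooth_right S π) := by
  have hact := (diff_principal (π := π) hext).smooth_act
  have hα : ∀ x, MDifferentiableAt 𝓘(ℝ, EA) 𝓘(ℝ, EB) α x :=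
    hext.smooth_left.mdifferentiable (by simp)
  refine ⟨fun q η => ?_, fun q a w => ?_⟩
  · have h₁ : MDifferentiableAt 𝓘(ℝ, EA) (diffManifold hext.smooth_right π).I
        (diffAct (π := π) hext q) 1 :=
      (hact.comp (contMDiff_const.prodMk contMDiff_id)).mdifferentiable (by simp) _
    refine (diffForm_mfderiv hext.smooth_right S h₁ η).trans ?_
    have h₂ := maurerCartan_mul (I' := 𝓘(ℝ, EA)) (f := fun _ : A => DiffSpace.grp q) (g := α)
      (x := (1 : A)) mdifferentiableAt_const (hα 1) η
    have h₄ := maurerCartan_const (EB := EB) (I' := 𝓘(ℝ, EA)) (1 : A) (DiffSpace.grp q) η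
    have h₅ := (congrArg (fun ξ : EB => Ad EB (α 1)⁻¹ ξ) h₄).trans (map_zero _)
    have h₆ := maurerCartan_one_apply (lieMap EA EB α η) (α 1) (map_one α)
    have h₇ := h₂.trans (congrArg₂ (fun x y : EB => x + y) h₅ h₆)
    refine (congrArg (fun ξ : EB => S.t ξ) (h₇.trans (zero_add _))).trans ?_
    exact S.retraction_t η
  · have h₁ : MDifferentiableAt (diffManifold hext.smooth_right π).I
        (diffManifold hext.smooth_right π).I
        (fun q => diffAct (π := π) hext q a) q :=
      (hact.comp (contMDiff_id.prodMk contMDiff_const)).mdifferentiable (by simp) _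
    refine (diffForm_mfderiv hext.smooth_right S h₁ w).trans ?_
    have h₂ := maurerCartan_mul (I' := (diffManifold hext.smooth_right π).I)
      (f := fun z : diffManifold hext.smooth_right π => DiffSpace.grp z) (g := fun _ => α a)
      (x := q) ((diff_smooth_grp hext.smooth_right).mdifferentiable (by simp) _)
      mdifferentiableAt_const w
    have h₄ := maurerCartan_const (EB := EB) (I' := (diffManifold hext.smooth_right π).I) q (α a) w
    have h₅ := h₂.trans (congrArg₂ (fun x y : EB => x + y) rfl h₄)
    refine (congrArg (fun ξ : EB => S.t ξ) (h₅.trans (add_zero _))).trans ?_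
    refine (S.t_Ad hext _ _).trans ?_
    exact (Ad_comm a⁻¹ _).symm

theorem diffForm_along (hβ : ContMDiff 𝓘(ℝ, EB) 𝓘(ℝ, EC) ∞ β)
    (S : AdSplitting EA EB EC α β) {c : ℝ → diffManifold hβ π}
    (hc : MDifferentiableAt 𝓘(ℝ, ℝ) (diffManifold hβ π).I c 0) :
    (diffForm hβ S π).along c =
      S.t (maurerCartan EB (DiffSpace.grp (c 0))
        (mfderiv 𝓘(ℝ, ℝ) 𝓘(ℝ, EB) (fun t => DiffSpace.grp (c t)) 0 (1 : ℝ))) :=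
  diffForm_mfderiv hβ S hc (1 : ℝ)

/-- The fibre bundle underlying a principal bundle. -/
theorem EquivariantBundle.isSmoothFibreBundle [LieGroup 𝓘(ℝ, EC) ∞ C]
    (π : EquivariantBundle X P EC C) :
    IsSmoothFibreBundle X.I P.I 𝓘(ℝ, EC) (F := C) π.proj := by
  refine ⟨π.principal.smooth_proj, fun x => ?_⟩
  obtain ⟨U, s, h, hU, hx, hs, hh, hs', hsh⟩ := π.principal.locTriv x (Set.mem_univ x)
  refine ⟨U, h, fun z => π.act (s z.1) z.2, hU, hx, hh, ?_, ?_, ?_⟩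
  · exact π.smooth_act.comp_contMDiffOn
      ((hs.comp contMDiffOn_fst fun z hz => hz.1).prodMk contMDiffOn_snd)
  · intro x hx c
    have h' := hs' x ⟨Set.mem_univ x, hx⟩
    exact ⟨(π.principal.proj_act _ _).trans h'.1, h'.2 c⟩
  · exact hsh

/-- The multiplication `((p₁, p₂, b), (p₂, p₃, b')) ↦ (p₁, p₃, b b')` of the difference bundle. -/
def diffMul {hβ : ContMDiff 𝓘(ℝ, EB) 𝓘(ℝ, EC) ∞ β} (f g : diffManifold hβ π)
    (h : DiffSpace.snd f = DiffSpace.fst g) : diffManifold hβ π :=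
  DiffSpace.mk (DiffSpace.fst f) (DiffSpace.snd g) (DiffSpace.grp f * DiffSpace.grp g) (by
    rw [map_mul, π.principal.act_mul, DiffSpace.eq f, h, DiffSpace.eq g])

/-- A smooth extension of the multiplication to all pairs. -/
def diffMulExt {hβ : ContMDiff 𝓘(ℝ, EB) 𝓘(ℝ, EC) ∞ β} (f g : diffManifold hβ π) :
    diffManifold hβ π :=
  DiffSpace.mk (DiffSpace.fst f) (π.act (DiffSpace.fst f) (β (DiffSpace.grp f * DiffSpace.grp g)))
    (DiffSpace.grp f * DiffSpace.grp g) rfl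

theorem diffMul_eq {hβ : ContMDiff 𝓘(ℝ, EB) 𝓘(ℝ, EC) ∞ β} (f g : diffManifold hβ π)
    (h : DiffSpace.snd f = DiffSpace.fst g) : diffMul f g h = diffMulExt f g :=
  DiffSpace.ext rfl (DiffSpace.eq (diffMul f g h)).symm rfl

theorem diffMulExt_smooth (hβ : ContMDiff 𝓘(ℝ, EB) 𝓘(ℝ, EC) ∞ β) :
    ContMDiff ((diffManifold hβ π).I.prod (diffManifold hβ π).I) (diffManifold hβ π).I ∞
      (fun z : diffManifold hβ π × diffManifold hβ π => diffMulExt z.1 z.2) := by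
  refine diff_contMDiff _ ?_ ?_
  · have h : ContMDiff ((diffManifold hβ π).I.prod (diffManifold hβ π).I) P.I ∞
        (fun z : diffManifold hβ π × diffManifold hβ π => DiffSpace.fst z.1) :=
      (diff_smooth_fst _).comp contMDiff_fst
    exact h
  · have h : ContMDiff ((diffManifold hβ π).I.prod (diffManifold hβ π).I) 𝓘(ℝ, EB) ∞
        (fun z : diffManifold hβ π × diffManifold hβ π => DiffSpace.grp z.1 * DiffSpace.grp z.2) :=
      ((diff_smooth_grp _).comp contMDiff_fst).mul ((diff_smooth_grp _).comp contMDiff_snd)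
    exact h

/-- The lifting gerbe of a `G`-equivariant principal `C`-bundle `π : P → X`, with its connective
structure: `Y = P`, and `Q` is the difference bundle, with multiplication
`((p₁, p₂, b), (p₂, p₃, b')) ↦ (p₁, p₃, b b')`. -/
def liftingGerbe [LieGroup 𝓘(ℝ, EA) ∞ A] [LieGroup 𝓘(ℝ, EC) ∞ C]
    (hext : IsCentralExtension EA EB EC α β) (S : AdSplitting EA EB EC α β)
    (π : EquivariantBundle X P EC C) : Gerbe X EA A where
  Y := P
  fibre :=
    { carrier := C
      E := EC
      H := EC
      I := 𝓘(ℝ, EC)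
      smooth := inferInstanceAs (IsManifold 𝓘(ℝ, EC) ∞ C) }
  proj := π.proj
  fibreBundle := π.isSmoothFibreBundle
  proj_smul := π.proj_smul
  Q := diffManifold hext.smooth_right π
  base z := (DiffSpace.fst z, DiffSpace.snd z)
  act := diffAct hext
  principal := diff_principal hext
  base_smul _ _ := rfl
  act_smul _ _ _ := rfl
  mul f g h := diffMul f g h
  mul_smooth _ := ⟨Set.univ, fun z => diffMulExt z.1 z.2, isOpen_univ, Set.mem_univ _,
    (diffMulExt_smooth _).contMDiffOn, fun y _ => diffMul_eq _ _ y.2⟩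
  base_mul _ _ _ := rfl
  mul_act f g a b h h' := by
    refine DiffSpace.ext rfl rfl ?_
    change DiffSpace.grp f * α a * (DiffSpace.grp g * α b) =
      DiffSpace.grp f * DiffSpace.grp g * α (a * b)
    rw [map_mul, mul_assoc, ← mul_assoc (α a), hext.central a]
    simp only [mul_assoc]
  mul_assoc f₁ f₂ f₃ _ _ _ _ := DiffSpace.ext rfl rfl (mul_assoc _ _ _)
  mul_smul _ _ _ _ _ := rfl
  connection := diffForm hext.smooth_right S π
  isConnection := diffForm_isConnection hext S
  invariant g z w := by
    have hg : MDifferentiableAt (diffManifold hext.smooth_right π).I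
        (diffManifold hext.smooth_right π).I
        (fun y : diffManifold hext.smooth_right π => g • y) z :=
      ((contMDiff_smul (I := 𝓘(ℝ, EG)) (I' := (diffManifold hext.smooth_right π).I) (n := ∞)
        (G := G) (M := diffManifold hext.smooth_right π)).comp
          (contMDiff_const.prodMk contMDiff_id)).mdifferentiable (by simp) _
    exact diffForm_mfderiv hext.smooth_right S hg w
  parallel f g h hf hg := by
    have hf' := hf.mdifferentiableAt (by simp)
    have hg' := hg.mdifferentiableAt (by simp)
    have hfb := ((diff_smooth_grp hext.smooth_right).mdifferentiable (by simp) (f 0)).comp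
      (0 : ℝ) hf'
    have hgb := ((diff_smooth_grp hext.smooth_right).mdifferentiable (by simp) (g 0)).comp
      (0 : ℝ) hg'
    have hm : MDifferentiableAt 𝓘(ℝ, ℝ) (diffManifold hext.smooth_right π).I
        (fun t => diffMulExt (f t) (g t)) 0 :=
      ((diffMulExt_smooth hext.smooth_right).mdifferentiable (by simp) (f 0, g 0)).comp (0 : ℝ)
        (hf'.prodMk hg')
    have hm' : (fun t => diffMul (f t) (g t) (h t)) = fun t => diffMulExt (f t) (g t) :=
      funext fun t => diffMul_eq _ _ (h t)
    have e₁ := diffForm_along hext.smooth_right S hm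
    have e₂ := maurerCartan_mul hfb hgb (1 : ℝ)
    have e₃ := congrArg (fun ξ : EB => S.t ξ) e₂
    refine (congrArg (diffForm hext.smooth_right S π).along hm').trans ?_
    refine e₁.trans (e₃.trans ?_)
    refine (map_add S.t _ _).trans ?_
    refine congrArg₂ (fun x y : EA => x + y) ?_ ?_
    · exact (S.t_Ad hext _ _).trans (diffForm_along hext.smooth_right S hf').symm
    · exact (diffForm_along hext.smooth_right S hg').symm

end DifferenceBundle

/-! ### Isomorphism classes -/

section Classes

variable {EG : Type*} [NormedAddCommGroup EG] [NormedSpace ℝ EG]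
  {G : Type*} [TopologicalSpace G] [ChartedSpace EG G] [Group G]
  {EA : Type*} [NormedAddCommGroup EA] [NormedSpace ℝ EA]
  {A : Type*} [TopologicalSpace A] [ChartedSpace EA A] [CommGroup A]
  {B : Type*} [TopologicalSpace B] [Group B]
  {EC : Type*} [NormedAddCommGroup EC] [NormedSpace ℝ EC]
  {C : Type*} [TopologicalSpace C] [ChartedSpace EC C] [Group C]
  {X : GManifold.{u₁, v₁} EG G} {P : GManifold.{u₂, v₂} EG G}

/-- Isomorphism classes of `G`-equivariant central extensions of `π` with admissible
`G`-equivariant connection. -/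
def ExtensionClasses {π : EquivariantBundle X P EC C}
    (EB : Type*) [NormedAddCommGroup EB] [NormedSpace ℝ EB] [ChartedSpace EB B]
    (β : B →* C) (ηπ : EquivariantConnection π) : Type _ :=
  Quot fun E E' : Σ R : GManifold.{u, v} EG G, AdmissibleExtension EB β ηπ R =>
    ∃ φ : Diffeomorph E.1.I E'.1.I E.1 E'.1 ∞, E.2.IsIso E'.2 φ

/-- Isomorphism classes of parallel `G`-equivariant trivializations of a gerbe. -/
def TrivializationClasses (𝒢 : Gerbe.{u₁, v₁, u₂, v₂, u₃, v₃, u₄, v₄} X EA A) : Type _ :=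
  Quot fun T T' : Σ R : GManifold.{u, v} EG G, ParallelTrivialization 𝒢 R =>
    ∃ φ : Diffeomorph T.1.I T'.1.I T.1 T'.1 ∞, T.2.IsIso T'.2 φ

end Classes

end

end LiftingGerbe

namespace LiftingGerbe

noncomputable section

/-! ### Tangent vectors as velocities of curves -/

/-! Both structures on `R` encode one function. Since `Q_P` consists of triples `(p₁, p₂, b)` and
`ψ` covers `σ × σ`, the isomorphism `ψ` is determined by `σ` and its `B`-component `d(r₁, r₂)`,
defined for `r₁, r₂` in the same fibre over `X`. Compatibility with the gerbe multiplication says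
that `d` is a cocycle, `d(r₁, r₂) d(r₂, r₃) = d(r₁, r₃)`, and `A`-equivariance gives `d(r₁, r₂ a) =
d(r₁, r₂) α(a)`.

For fixed `r`, the map `d(r, ·)` is a bijection from the fibre through `r` to `B`. It is injective
because `d` determines the point of `P` and `α` is injective (`eq_of_diff_eq`). It is surjective
because `R → P` is onto and a wrong value of `d` can be corrected by an element of `ker β = α(A)`
(`exists_diff_eq`). So `r b` can be defined as the unique `r'` with `d(r, r') = b`; the cocycle
identity makes this an action, and `d` becomes the division map of the resulting principal
`B`-bundle. For a given `B`-bundle, `d` is taken to be its division map. The two constructions are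
therefore inverse to each other. Smoothness comes from local sections of `π`, `σ` and `β`
(`σ_principal`, `liftAct_smooth`, `lift_principal`).

For the connections, the splitting decomposes the Lie algebra of `B` as `α_* 𝔞 ⊕ s 𝔠`. `Ad` is
trivial on the first summand by centrality and commutes with `s` on the second, so that `t ∘ Ad =
t`. A form `ω` with values in `𝔟` is the pair `(t ω, β_* ω)`; admissibility prescribes the second
entry, hence `ω^ρ` and `ω^σ` determine each other, with `ω^ρ = α_* ω^σ + s (σ^* ω^π)`. Under this
dictionary, parallelism of `ψ` is the `t`-part of the product rule `ω((c b)') = Ad_{b⁻¹} ω(c') + b⁻¹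
b'`. It holds for a connection `ω^ρ` (`mfderiv_act`); conversely, for a trivialization, it gives the
behaviour of `ω^σ` under all of `B` (`along_liftAct`), where tangent vectors are realised as
velocities of curves (`exists_curve`).

A diffeomorphism over `P` preserves `ψ` exactly when it preserves `d`, that is, when it is
`B`-equivariant; it preserves the `𝔠`-component of the connections automatically. -/

/-- Every tangent vector of a manifold without boundary is the velocity of a smooth curve. -/
theorem exists_curve {E H M : Type*} [NormedAddCommGroup E] [NormedSpace ℝ E] [TopologicalSpace H]
    {I : ModelWithCorners ℝ E H} [I.Boundaryless] [TopologicalSpace M] [ChartedSpace H M]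
    [IsManifold I ∞ M] (x : M) (w : E) :
    ∃ c : ℝ → M, c 0 = x ∧ ContMDiffAt 𝓘(ℝ, ℝ) I ∞ c 0 ∧
      @Eq E (mfderiv 𝓘(ℝ, ℝ) I c 0 (1 : ℝ)) w := by
  -- The curve is a straight line in the chart at `x`. Without boundary the target of this chart is
  -- a neighbourhood of its centre, so the line stays in it for small times. The same chart
  -- identifies the tangent space at `x` with `E`, so the velocity is `w` with no change of
  -- coordinates.
  let l : ℝ → E := fun t => extChartAt I x x + t • w
  let c : ℝ → M := fun t => (extChartAt I x).symm (l t)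
  have hl0 : l 0 = extChartAt I x x := by simp [l]
  have hc0 : c 0 = x := by simp only [c, hl0, extChartAt_to_inv]
  have hl : ContDiff ℝ ∞ l := contDiff_const.add (contDiff_id.smul contDiff_const)
  have hmem : (extChartAt I x).target ∈ 𝓝 (l 0) := hl0 ▸ extChartAt_target_mem_nhds (I := I) x
  have hc : ContMDiffAt 𝓘(ℝ, ℝ) I ∞ c 0 :=
    ((contMDiffOn_extChartAt_symm x).contMDiffAt hmem).comp (0 : ℝ) hl.contMDiff.contMDiffAt
  have hev : ∀ᶠ t in 𝓝 (0 : ℝ), extChartAt I x (c t) = l t := by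
    filter_upwards [hl.continuous.continuousAt.preimage_mem_nhds hmem] with t ht
    exact (extChartAt I x).right_inv ht
  have hd : HasFDerivAt l (ContinuousLinearMap.toSpanSingleton ℝ w) 0 := by
    have h : HasDerivAt l w 0 := by
      simpa [l] using ((hasDerivAt_id (0 : ℝ)).smul_const w).const_add (extChartAt I x x)
    exact h.hasFDerivAt
  have hD : HasMFDerivAt 𝓘(ℝ, ℝ) I c 0
      (ContinuousLinearMap.toSpanSingleton ℝ w : ℝ →L[ℝ] E) := by
    refine ⟨hc.continuousAt, ?_⟩
    have he : writtenInExtChartAt 𝓘(ℝ, ℝ) I 0 c = fun t => extChartAt I x (c t) := by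
      funext t
      simp only [writtenInExtChartAt, hc0]
      rfl
    rw [he]
    exact (hd.congr_of_eventuallyEq hev).hasFDerivWithinAt
  refine ⟨c, hc0, hc, ?_⟩
  refine (congrArg (fun T : ℝ →L[ℝ] E => T 1) hD.mfderiv).trans ?_
  exact ContinuousLinearMap.toSpanSingleton_apply_one ℝ w

/-- The composition of a smooth map on a subset with a smooth map into this subset. -/
theorem SmoothOnSubset.contMDiffAt {E₁ H₁ E₂ H₂ E₃ H₃ : Type*} [NormedAddCommGroup E₁]
    [NormedSpace ℝ E₁] [TopologicalSpace H₁] [NormedAddCommGroup E₂] [NormedSpace ℝ E₂]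
    [TopologicalSpace H₂] [NormedAddCommGroup E₃] [NormedSpace ℝ E₃] [TopologicalSpace H₃]
    {I₁ : ModelWithCorners ℝ E₁ H₁} {I₂ : ModelWithCorners ℝ E₂ H₂}
    {I₃ : ModelWithCorners ℝ E₃ H₃}
    {M : Type*} [TopologicalSpace M] [ChartedSpace H₁ M]
    {N : Type*} [TopologicalSpace N] [ChartedSpace H₂ N]
    {F : Type*} [TopologicalSpace F] [ChartedSpace H₃ F] {S : Set M} {f : S → N}
    (hf : SmoothOnSubset I₁ I₂ f) {g : F → M} {φ : F → N} {x : F}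
    (hg : ContMDiffAt I₃ I₁ ∞ g x) (hφ : ∀ᶠ y in 𝓝 x, ∃ h : g y ∈ S, φ y = f ⟨g y, h⟩) :
    ContMDiffAt I₃ I₂ ∞ φ x := by
  obtain ⟨hx, -⟩ := hφ.self_of_nhds
  obtain ⟨U, k, hU, hxU, hk, hkf⟩ := hf ⟨g x, hx⟩
  have h := (hk.contMDiffAt (hU.mem_nhds hxU)).comp x hg
  refine h.congr_of_eventuallyEq ?_
  filter_upwards [hφ, hg.continuousAt.preimage_mem_nhds (hU.mem_nhds hxU)] with y ⟨hy, hφy⟩ hyU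
  exact hφy.trans (hkf ⟨g y, hy⟩ hyU)

/-! ### Operations on one-forms -/

section OneForm

variable {M : SmoothManifold.{u, v}}
  {EK : Type*} [NormedAddCommGroup EK] [NormedSpace ℝ EK]
  {K : Type*} [TopologicalSpace K] [ChartedSpace EK K] [Group K]
  {EL : Type*} [NormedAddCommGroup EL] [NormedSpace ℝ EL]
  {L : Type*} [TopologicalSpace L] [ChartedSpace EL L] [Group L]

/-- Tangent spaces at different points are different types that all unfold to the model space.
Stating equalities in `EK`, with tangent vectors taken in `M.E`, allows a base point to be replaced
along an equality that is not definitional. -/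
theorem OneForm.toFun_congr (η : OneForm M EK K) {x y : M} (h : x = y) (w : M.E) :
    @Eq EK (η.toFun x w) (η.toFun y w) := by
  subst h; rfl

/-- The base point and the derivative have to change together, since the type of the one depends on
the other. -/
theorem OneForm.toFun_mfderiv_congr (η : OneForm M EK K) {E H N : Type*} [NormedAddCommGroup E]
    [NormedSpace ℝ E] [TopologicalSpace H] {I : ModelWithCorners ℝ E H} [TopologicalSpace N]
    [ChartedSpace H N] {f g : N → M} (h : ∀ x, f x = g x) (x : N) (w : TangentSpace I x) :
    @Eq EK (η.toFun (f x) (mfderiv I M.I f x w)) (η.toFun (g x) (mfderiv I M.I g x w)) := by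
  obtain rfl : f = g := funext h
  rfl

/-- The image of a one-form under a continuous linear map of Lie algebras. -/
def OneForm.map (η : OneForm M EK K) (T : LieAlg EK K →L[ℝ] LieAlg EL L) : OneForm M EL L where
  toFun x := T.comp (η.toFun x)
  smooth := by
    have h : ContMDiff (M := EK) (M' := EL) 𝓘(ℝ, EK) 𝓘(ℝ, EL) ∞ T :=
      ContinuousLinearMap.contMDiff (E := EK) (F := EL) T
    exact h.comp η.smooth

instance : Add (OneForm M EK K) where
  add η θ :=
    { toFun := fun x => η.toFun x + θ.toFun x
      smooth := ContMDiff.add (G := EK) (I := 𝓘(ℝ, EK)) η.smooth θ.smooth }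

/-- The pullback of a one-form along a smooth map. -/
def OneForm.pullback {N : SmoothManifold.{u₁, v₁}} (η : OneForm M EK K) (f : N → M)
    (hf : ContMDiff N.I M.I ∞ f) : OneForm N EK K where
  toFun x := (η.toFun (f x)).comp (mfderiv N.I M.I f x)
  smooth := η.smooth.comp (ContMDiff.contMDiff_tangentMap (m := ∞) hf le_rfl)

theorem OneForm.pullback_mfderiv {N : SmoothManifold.{u₁, v₁}} (η : OneForm M EK K) {f : N → M}
    (hf : ContMDiff N.I M.I ∞ f) {E H F : Type*} [NormedAddCommGroup E] [NormedSpace ℝ E]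
    [TopologicalSpace H] {I : ModelWithCorners ℝ E H} [TopologicalSpace F] [ChartedSpace H F]
    {g : F → N} {x : F} (hg : MDifferentiableAt I N.I g x) (w : TangentSpace I x) :
    @Eq EK ((η.pullback f hf).toFun (g x) (mfderiv I N.I g x w))
      (η.toFun (f (g x)) (mfderiv I M.I (fun y => f (g y)) x w)) := by
  have h := mfderiv_comp_apply (I := I) (I' := N.I) (I'' := M.I) x (g := f) (f := g)
    (hf.mdifferentiable (by simp) _) hg w
  exact congrArg (fun w : M.E => (η.toFun (f (g x)) w : EK)) h.symm

theorem OneForm.along_const (η : OneForm M EK K) (x : M) :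
    @Eq EK (η.along fun _ => x) 0 := by
  have h : @Eq M.E (mfderiv 𝓘(ℝ, ℝ) M.I (fun _ : ℝ => x) 0 (1 : ℝ)) 0 :=
    congrArg (fun T : ℝ →L[ℝ] M.E => T 1) mfderiv_const
  exact (congrArg (fun w : M.E => (η.toFun x w : EK)) h).trans (map_zero (η.toFun x))

/-- The value of a one-form on the velocity of the image of a curve. -/
theorem OneForm.along_comp (η : OneForm M EK K) {E H N : Type*} [NormedAddCommGroup E]
    [NormedSpace ℝ E] [TopologicalSpace H] {I : ModelWithCorners ℝ E H} [TopologicalSpace N]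
    [ChartedSpace H N] {c : ℝ → N} {x : N} {w : TangentSpace I x} (hc0 : c 0 = x)
    (hc : MDifferentiableAt 𝓘(ℝ, ℝ) I c 0) (hw : @Eq E (mfderiv 𝓘(ℝ, ℝ) I c 0 (1 : ℝ)) w)
    {f : N → M} (hf : MDifferentiableAt I M.I f x) :
    @Eq EK (η.along fun t => f (c t)) (η.toFun (f x) (mfderiv I M.I f x w)) := by
  subst hc0
  have h := mfderiv_comp_apply (I := 𝓘(ℝ, ℝ)) (I' := I) (I'' := M.I) (0 : ℝ) (g := f) (f := c)
    hf hc (1 : ℝ)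
  refine (congrArg (fun w : M.E => (η.toFun (f (c 0)) w : EK)) h).trans ?_
  exact congrArg (fun w : E => (η.toFun (f (c 0)) (mfderiv I M.I f (c 0) w) : EK)) hw

theorem OneForm.along_eq (η : OneForm M EK K) {c : ℝ → M} {x : M} {w : TangentSpace M.I x}
    (hc0 : c 0 = x) (hw : @Eq M.E (mfderiv 𝓘(ℝ, ℝ) M.I c 0 (1 : ℝ)) w) :
    @Eq EK (η.along c) (η.toFun x w) := by
  subst hc0
  exact congrArg (fun w : M.E => (η.toFun (c 0) w : EK)) hw

end OneForm

/-! ### Principal bundles -/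

section Principal

variable {E₁ H₁ E₂ H₂ : Type*} [NormedAddCommGroup E₁] [NormedSpace ℝ E₁]
  [TopologicalSpace H₁] [NormedAddCommGroup E₂] [NormedSpace ℝ E₂] [TopologicalSpace H₂]
  {I₁ : ModelWithCorners ℝ E₁ H₁} {I₂ : ModelWithCorners ℝ E₂ H₂}
  {M : Type*} [TopologicalSpace M] [ChartedSpace H₁ M]
  {N : Type*} [TopologicalSpace N] [ChartedSpace H₂ N]
  {EK : Type*} [NormedAddCommGroup EK] [NormedSpace ℝ EK]
  {K : Type*} [TopologicalSpace K] [ChartedSpace EK K] [Group K]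
  {S : Set M} {π : N → M} {act : N → K → N}

namespace IsPrincipalBundle

theorem exists_proj_eq (hπ : IsPrincipalBundle I₁ I₂ EK S π act) {x : M} (hx : x ∈ S) :
    ∃ q, π q = x := by
  obtain ⟨U, s, h, -, hxU, -, -, hs, -⟩ := hπ.locTriv x hx
  exact ⟨s x, (hs x ⟨hx, hxU⟩).1⟩

/-- Local trivializations in terms of the fibre coordinate `h`. -/
theorem exists_coord (hπ : IsPrincipalBundle I₁ I₂ EK S π act) {x : M} (hx : x ∈ S) :
    ∃ (U : Set M) (h : N → K), IsOpen U ∧ x ∈ U ∧ ContMDiffOn I₂ 𝓘(ℝ, EK) ∞ h (π ⁻¹' U) ∧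
      (∀ q k, π q ∈ U → h (act q k) = h q * k) ∧
      ∀ q q', π q ∈ U → π q = π q' → act q ((h q)⁻¹ * h q') = q' := by
  obtain ⟨U, s, h, hU, hxU, -, hh, hs, hsh⟩ := hπ.locTriv x hx
  refine ⟨U, h, hU, hxU, hh, fun q k hq => ?_, fun q q' hq hqq' => ?_⟩
  -- Since `q = s (π q) · h q`, also `q · k = s (π q) · (h q * k)`, and the coordinate of the
  -- right-hand side is read off from the trivialization.
  · conv_lhs => rw [← hsh q hq, ← hπ.act_mul]
    exact (hs _ ⟨hπ.proj_mem q, hq⟩).2 _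
  · have hq₀ : ∀ k, act q k = act (s (π q)) (h q * k) := fun k => by rw [hπ.act_mul, hsh q hq]
    rw [hq₀, mul_inv_cancel_left, hqq']
    exact hsh q' (hqq' ▸ hq)

/-- In a fibre coordinate the action is right multiplication, which is free. -/
theorem act_right_injective (hπ : IsPrincipalBundle I₁ I₂ EK S π act) (q : N) :
    Function.Injective (act q) := by
  intro k l hkl
  obtain ⟨U, h, -, hqU, -, hact, -⟩ := hπ.exists_coord (hπ.proj_mem q)
  have := congrArg h hkl
  rwa [hact q k hqU, hact q l hqU, mul_right_inj] at this

theorem exists_act_eq (hπ : IsPrincipalBundle I₁ I₂ EK S π act) {q q' : N} (h : π q = π q') :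
    ∃ k, act q k = q' := by
  obtain ⟨U, f, -, hqU, -, -, hf⟩ := hπ.exists_coord (hπ.proj_mem q)
  exact ⟨_, hf q q' hqU h⟩

/-- The difference of two points in the same fibre. -/
def div (hπ : IsPrincipalBundle I₁ I₂ EK S π act) {q q' : N} (h : π q = π q') : K :=
  (hπ.exists_act_eq h).choose

theorem act_div (hπ : IsPrincipalBundle I₁ I₂ EK S π act) {q q' : N} (h : π q = π q') :
    act q (hπ.div h) = q' :=
  (hπ.exists_act_eq h).choose_spec

theorem div_eq (hπ : IsPrincipalBundle I₁ I₂ EK S π act) {q q' : N} (h : π q = π q') {k : K}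
    (hk : act q k = q') : hπ.div h = k :=
  hπ.act_right_injective q ((hπ.act_div h).trans hk.symm)

/-- In a fibre coordinate `h` the quotient is `(h q)⁻¹ * h q'`. This expression makes sense for all
pairs over `U`, in the same fibre or not, and so provides the ambient extension that
`SmoothOnSubset` requires. -/
theorem div_smooth [LieGroup 𝓘(ℝ, EK) ∞ K] (hπ : IsPrincipalBundle I₁ I₂ EK S π act) :
    SmoothOnSubset (I₂.prod I₂) 𝓘(ℝ, EK)
      (fun z : {z : N × N | π z.1 = π z.2} => hπ.div z.2) := by
  rintro ⟨⟨q, q'⟩, hqq' : π q = π q'⟩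
  obtain ⟨U, h, hU, hqU, hh, -, hdiv⟩ := hπ.exists_coord (hπ.proj_mem q)
  have hV : IsOpen (π ⁻¹' U) := hU.preimage hπ.smooth_proj.continuous
  have hqU' : π q' ∈ U := hqq' ▸ hqU
  refine ⟨(π ⁻¹' U) ×ˢ (π ⁻¹' U), fun z => (h z.1)⁻¹ * h z.2, hV.prod hV, ⟨hqU, hqU'⟩, ?_, ?_⟩
  · exact ContMDiffOn.mul (I := 𝓘(ℝ, EK))
      (ContMDiffOn.inv (I := 𝓘(ℝ, EK)) (hh.comp contMDiffOn_fst fun z hz => hz.1))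
      (hh.comp contMDiffOn_snd fun z hz => hz.2)
  · exact fun z hz => hπ.div_eq z.2 (hdiv _ _ hz.1 z.2)

theorem act_smooth_left (hπ : IsPrincipalBundle I₁ I₂ EK S π act) (k : K) :
    ContMDiff I₂ I₂ ∞ (fun q => act q k) :=
  hπ.smooth_act.comp (contMDiff_id.prodMk contMDiff_const)

theorem act_smooth_right (hπ : IsPrincipalBundle I₁ I₂ EK S π act) (q : N) :
    ContMDiff 𝓘(ℝ, EK) I₂ ∞ (act q) :=
  hπ.smooth_act.comp (contMDiff_const.prodMk contMDiff_id)

end IsPrincipalBundle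

end Principal

/-! ### Connection forms and the product rule -/

section ProductRule

variable {M : SmoothManifold.{u, v}}
  {EK : Type*} [NormedAddCommGroup EK] [NormedSpace ℝ EK]
  {K : Type*} [TopologicalSpace K] [ChartedSpace EK K] [Group K]
  {act : M → K → M} {η : OneForm M EK K}

variable [LieGroup 𝓘(ℝ, EK) ∞ K]

/-- The value of a connection on tangent vectors along the fibres. -/
theorem IsConnectionForm.vertical_apply (hη : IsConnectionForm EK act η)
    (hact : ContMDiff (M.I.prod 𝓘(ℝ, EK)) M.I ∞ (fun z : M × K => act z.1 z.2))
    (act_mul : ∀ q k l, act q (k * l) = act (act q k) l) (p : M) (k : K) (ξ : EK) :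
    @Eq EK (η.toFun (act p k) (mfderiv 𝓘(ℝ, EK) M.I (act p) k ξ)) (maurerCartan EK k ξ) := by
  have hr : ∀ q, ContMDiff 𝓘(ℝ, EK) M.I ∞ (act q) := fun q =>
    hact.comp (contMDiff_const.prodMk contMDiff_id)
  -- Translating by `k⁻¹` moves the tangent vector from `k` to the identity, where `vertical`
  -- applies at the point `p k`. The derivative of this translation is the Maurer-Cartan form.
  have hk : act p = act (act p k) ∘ fun x => k⁻¹ * x := by
    funext x
    simp only [Function.comp_apply, ← act_mul, mul_inv_cancel_left]
  have h₁ := mfderiv_comp_apply (I := 𝓘(ℝ, EK)) (I' := 𝓘(ℝ, EK)) (I'' := M.I)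
    k (g := act (act p k)) (f := fun x : K => k⁻¹ * x) ((hr _).mdifferentiable (by simp) _)
    ((contMDiff_mul_left (n := ∞)).mdifferentiable (by simp) _) ξ
  have h₂ : @Eq M.E (mfderiv 𝓘(ℝ, EK) M.I (act p) k ξ)
      (mfderiv 𝓘(ℝ, EK) M.I (act (act p k)) (k⁻¹ * k) (maurerCartan EK k ξ)) :=
    Eq.trans (congrArg (fun T : EK →L[ℝ] M.E => T ξ) (mfderiv_congr hk)) h₁
  have h₃ : @Eq M.E (mfderiv 𝓘(ℝ, EK) M.I (act (act p k)) (k⁻¹ * k) (maurerCartan EK k ξ))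
      (mfderiv 𝓘(ℝ, EK) M.I (act (act p k)) 1 (maurerCartan EK k ξ)) :=
    congrArg (fun T : EK →L[ℝ] M.E => T (maurerCartan EK k ξ))
      (mfderiv_congr_point (inv_mul_cancel k))
  refine (congrArg (fun w : M.E => (η.toFun (act p k) w : EK)) (h₂.trans h₃)).trans ?_
  refine (η.toFun_congr ?_ _).trans (hη.vertical (act p k) (maurerCartan EK k ξ))
  rw [← act_mul, mul_one]

/-- The product rule for a connection form. -/
theorem IsConnectionForm.mfderiv_act (hη : IsConnectionForm EK act η)
    (hact : ContMDiff (M.I.prod 𝓘(ℝ, EK)) M.I ∞ (fun z : M × K => act z.1 z.2))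
    (act_mul : ∀ q k l, act q (k * l) = act (act q k) l)
    {E' H' : Type*} [NormedAddCommGroup E'] [NormedSpace ℝ E']
    [TopologicalSpace H'] {I' : ModelWithCorners ℝ E' H'} {N : Type*} [TopologicalSpace N]
    [ChartedSpace H' N] {f : N → M} {g : N → K} {x : N} (hf : MDifferentiableAt I' M.I f x)
    (hg : MDifferentiableAt I' 𝓘(ℝ, EK) g x) (w : TangentSpace I' x) :
    @Eq EK (η.toFun (act (f x) (g x)) (mfderiv I' M.I (fun y => act (f y) (g y)) x w))
      (Ad EK (g x)⁻¹ (η.toFun (f x) (mfderiv I' M.I f x w)) +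
        maurerCartan EK (g x) (mfderiv I' 𝓘(ℝ, EK) g x w)) := by
  have hd := hact.mdifferentiable (by simp)
  -- The derivative of the action splits into its two partial derivatives: the connection evaluates
  -- the first by equivariance and the second by `vertical_apply`.
  have h₁ : @Eq M.E (mfderiv I' M.I (fun y => act (f y) (g y)) x w)
      ((mfderiv M.I M.I (fun z : M => act z (g x)) (f x) (mfderiv I' M.I f x w) : M.E) +
        (mfderiv 𝓘(ℝ, EK) M.I (act (f x)) (g x) (mfderiv I' 𝓘(ℝ, EK) g x w) : M.E)) := by
    have h := mfderiv_comp_apply (I := I') (I' := M.I.prod 𝓘(ℝ, EK)) (I'' := M.I)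
      x (g := fun p : M × K => act p.1 p.2) (f := fun y => (f y, g y)) (hd _) (hf.prodMk hg) w
    refine Eq.trans h ?_
    refine Eq.trans (mfderiv_prod_eq_add_apply (hd (f x, g x))) ?_
    have h' := mfderiv_prodMk hf hg
    refine congrArg (fun T : E' →L[ℝ] M.E × EK =>
      (mfderiv M.I M.I (fun z : M => act z (g x)) (f x) (T w).1 : M.E) +
        (mfderiv 𝓘(ℝ, EK) M.I (act (f x)) (g x) (T w).2 : M.E)) h'
  refine (congrArg (fun w : M.E => (η.toFun (act (f x) (g x)) w : EK)) h₁).trans ?_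
  refine Eq.trans (map_add (η.toFun (act (f x) (g x))) _ _) ?_
  exact congrArg₂ (fun a b : EK => a + b) (hη.equivariant (f x) (g x) (mfderiv I' M.I f x w))
    (hη.vertical_apply hact act_mul (f x) (g x) (mfderiv I' 𝓘(ℝ, EK) g x w))

/-- The value of a connection on tangent vectors along an orbit of a group acting through a
homomorphism. -/
theorem IsConnectionForm.mfderiv_act_hom (hη : IsConnectionForm EK act η)
    (hact : ContMDiff (M.I.prod 𝓘(ℝ, EK)) M.I ∞ (fun z : M × K => act z.1 z.2))
    (act_mul : ∀ q k l, act q (k * l) = act (act q k) l)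
    {EL : Type*} [NormedAddCommGroup EL] [NormedSpace ℝ EL]
    {L : Type*} [TopologicalSpace L] [ChartedSpace EL L] [Group L] {φ : L →* K}
    (hφ : MDifferentiableAt 𝓘(ℝ, EL) 𝓘(ℝ, EK) φ 1) (p : M) (ξ : LieAlg EL L) :
    @Eq EK (η.toFun (act p (φ 1)) (mfderiv 𝓘(ℝ, EL) M.I (fun l => act p (φ l)) 1 ξ))
      (lieMap EL EK φ ξ) := by
  -- In the product rule the factor `p` is constant, so the `Ad` term vanishes; the Maurer-Cartan
  -- form is the identity at `φ 1 = 1`.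
  refine (hη.mfderiv_act hact act_mul (f := fun _ => p) mdifferentiableAt_const hφ ξ).trans ?_
  have h₀ : @Eq M.E (mfderiv 𝓘(ℝ, EL) M.I (fun _ : L => p) 1 ξ) 0 :=
    congrArg (fun T : EL →L[ℝ] M.E => T ξ) mfderiv_const
  have h₁ := (congrArg (fun w : M.E => (Ad EK (φ 1)⁻¹ (η.toFun p w) : EK)) h₀).trans
    ((congrArg (fun w : EK => (Ad EK (φ 1)⁻¹ w : EK)) (map_zero (η.toFun p))).trans (map_zero _))
  exact (congrArg₂ (fun x y : EK => x + y) h₁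
    (maurerCartan_one_apply (lieMap EL EK φ ξ) (φ 1) (map_one φ))).trans (zero_add _)

end ProductRule

/-! ### The central extension and its Lie algebras -/

section CentralExtension

variable {EA : Type*} [NormedAddCommGroup EA] [NormedSpace ℝ EA]
  {A : Type*} [TopologicalSpace A] [ChartedSpace EA A] [CommGroup A]
  {EB : Type*} [NormedAddCommGroup EB] [NormedSpace ℝ EB]
  {B : Type*} [TopologicalSpace B] [ChartedSpace EB B] [Group B]
  {EC : Type*} [NormedAddCommGroup EC] [NormedSpace ℝ EC]
  {C : Type*} [TopologicalSpace C] [ChartedSpace EC C] [Group C]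
  {α : A →* B} {β : B →* C}

theorem IsCentralExtension.map_left (hext : IsCentralExtension EA EB EC α β) (a : A) :
    β (α a) = 1 :=
  (hext.mem_ker _).2 ⟨a, rfl⟩

/-- A smooth left inverse of `A → B` near its image. -/
theorem IsCentralExtension.exists_leftInverse [LieGroup 𝓘(ℝ, EA) ∞ A]
    (hext : IsCentralExtension EA EB EC α β) :
    ∃ (W : Set B) (l : B → A), IsOpen W ∧ (∀ a, α a ∈ W) ∧
      ContMDiffOn 𝓘(ℝ, EB) 𝓘(ℝ, EA) ∞ l W ∧ ∀ a, l (α a) = a := by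
  obtain ⟨U, h, hU, h1U, hh, hact, -⟩ := hext.principal.exists_coord (Set.mem_univ 1)
  -- The image of `α` lies in the fibre of `β` over `1`. A fibre coordinate `h` of the bundle `β`
  -- satisfies `h (α a) = h 1 * a`, so dividing by `h 1` gives a left inverse of `α` that is smooth
  -- on a whole neighbourhood in `B`.
  refine ⟨β ⁻¹' U, fun b => (h 1)⁻¹ * h b, hU.preimage hext.smooth_right.continuous, fun a => ?_,
    ContMDiffOn.mul (I := 𝓘(ℝ, EA)) contMDiffOn_const hh, fun a => ?_⟩
  · rwa [Set.mem_preimage, hext.map_left]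
  · have := hact 1 a (by rwa [map_one])
    rw [one_mul] at this
    exact (congrArg ((h 1)⁻¹ * ·) this).trans (inv_mul_cancel_left _ _)

theorem IsCentralExtension.lieMap_lieMap (hext : IsCentralExtension EA EB EC α β)
    (η : LieAlg EA A) : lieMap EB EC β (lieMap EA EB α η) = 0 := by
  have h := mfderiv_comp_apply (I := 𝓘(ℝ, EA)) (I' := 𝓘(ℝ, EB)) (I'' := 𝓘(ℝ, EC))
    (1 : A) (g := β) (f := α) (hext.smooth_right.mdifferentiable (by simp) _)
    (hext.smooth_left.mdifferentiable (by simp) _) η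
  have h' : β ∘ α = fun _ => (1 : C) := funext hext.map_left
  have e : @Eq EC (lieMap EB EC β (lieMap EA EB α η))
      (mfderiv 𝓘(ℝ, EB) 𝓘(ℝ, EC) β (α 1) (mfderiv 𝓘(ℝ, EA) 𝓘(ℝ, EB) α 1 η)) :=
    congrArg (fun T : EB →L[ℝ] EC => T (lieMap EA EB α η)) (mfderiv_congr_point (by simp))
  refine e.trans (Eq.trans h.symm ?_)
  refine (congrArg (fun T : EA →L[ℝ] EC => T η) (mfderiv_congr h')).trans ?_
  exact congrArg (fun T : EA →L[ℝ] EC => T η) mfderiv_const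

/-- An element of the Lie algebra of `B` is determined by its two components. -/
theorem AdSplitting.ext_iff (S : AdSplitting EA EB EC α β) {ξ ξ' : LieAlg EB B} :
    ξ = ξ' ↔ S.t ξ = S.t ξ' ∧ lieMap EB EC β ξ = lieMap EB EC β ξ' := by
  refine ⟨fun h => ⟨by rw [h], by rw [h]⟩, fun h => ?_⟩
  rw [← S.add_eq ξ, ← S.add_eq ξ', h.1, h.2]

end CentralExtension

end

end LiftingGerbe

namespace LiftingGerbe

noncomputable section

/-! ### From central extensions to trivializations -/

section Forward

variable {EG : Type*} [NormedAddCommGroup EG] [NormedSpace ℝ EG]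
  {G : Type*} [TopologicalSpace G] [ChartedSpace EG G] [Group G]
  {EA : Type*} [NormedAddCommGroup EA] [NormedSpace ℝ EA]
  {A : Type*} [TopologicalSpace A] [ChartedSpace EA A] [CommGroup A]
  {EB : Type*} [NormedAddCommGroup EB] [NormedSpace ℝ EB]
  {B : Type*} [TopologicalSpace B] [ChartedSpace EB B] [Group B]
  {EC : Type*} [NormedAddCommGroup EC] [NormedSpace ℝ EC]
  {C : Type*} [TopologicalSpace C] [ChartedSpace EC C] [Group C]
  {X : GManifold.{u₁, v₁} EG G} {P : GManifold.{u₂, v₂} EG G}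
  {α : A →* B} {β : B →* C} {π : EquivariantBundle X P EC C} {ηπ : EquivariantConnection π}
  {R : GManifold.{u, v} EG G}

theorem GManifold.mdifferentiable_smul (M : GManifold.{u, v} EG G) (g : G) :
    MDifferentiable M.I M.I (fun x : M => g • x) :=
  ((contMDiff_smul (I := 𝓘(ℝ, EG)) (I' := M.I) (n := ∞) (G := G) (M := M)).comp
    (contMDiff_const.prodMk contMDiff_id)).mdifferentiable (by simp)

/-- The difference of two points of a principal bundle is invariant under the action of `G`. -/
theorem EquivariantBundle.div_smul (ρ : EquivariantBundle X R EB B) (g : G) {r₁ r₂ : R}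
    (h : ρ.proj r₁ = ρ.proj r₂) (h' : ρ.proj (g • r₁) = ρ.proj (g • r₂)) :
    ρ.principal.div h' = ρ.principal.div h :=
  ρ.principal.div_eq h' (by rw [ρ.act_smul, ρ.principal.act_div])

/-- The velocity of a curve multiplied by a curve in the group, in terms of a connection. -/
theorem EquivariantConnection.along_act [LieGroup 𝓘(ℝ, EB) ∞ B]
    {ρ : EquivariantBundle X R EB B} (θ : EquivariantConnection ρ)
    {c : ℝ → R} {b : ℝ → B} (hc : MDifferentiableAt 𝓘(ℝ, ℝ) R.I c 0)
    (hb : MDifferentiableAt 𝓘(ℝ, ℝ) 𝓘(ℝ, EB) b 0) :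
    @Eq EB (θ.form.along fun t => ρ.act (c t) (b t))
      (Ad EB (b 0)⁻¹ (θ.form.along c) +
        maurerCartan EB (b 0) (mfderiv 𝓘(ℝ, ℝ) 𝓘(ℝ, EB) b 0 (1 : ℝ))) :=
  θ.isConnection.mfderiv_act ρ.principal.smooth_act ρ.principal.act_mul hc hb (1 : ℝ)

namespace AdmissibleExtension

variable (E : AdmissibleExtension EB β ηπ R)

theorem proj_eq_iff {r₁ r₂ : R} :
    π.proj (E.σ r₁) = π.proj (E.σ r₂) ↔ E.bundle.proj r₁ = E.bundle.proj r₂ := by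
  rw [E.proj_σ, E.proj_σ]

/-- With a local section `s` of `R → X`, a point `q` of `P` is `σ (s (π q)) · d q` for a smooth
`C`-valued `d`. Lifting `d q` to `B` by a local section of `β` and letting it act on `s (π q)` gives
a point of `R` over `q`, hence a local section of `σ`. The `A`-coordinate of `r` is the
`A`-coordinate, in the bundle `β`, of its `B`-coordinate `h r`. -/
theorem σ_principal [LieGroup 𝓘(ℝ, EC) ∞ C] (hext : IsCentralExtension EA EB EC α β) :
    IsPrincipalBundle P.I R.I EA Set.univ E.σ (fun r a => E.bundle.act r (α a)) where
  smooth_proj := E.smooth_σ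
  proj_mem _ := Set.mem_univ _
  smooth_act := E.bundle.principal.smooth_act.comp
    (contMDiff_fst.prodMk (hext.smooth_left.comp contMDiff_snd))
  act_one r := by rw [map_one, E.bundle.principal.act_one]
  act_mul r a b := by rw [map_mul, E.bundle.principal.act_mul]
  proj_act r a := by rw [E.σ_act, hext.map_left, π.principal.act_one]
  locTriv := by
    intro p _
    obtain ⟨U, s, h, hU, hpU, hs, hh, hs', hsh⟩ :=
      E.bundle.principal.locTriv (π.proj p) (Set.mem_univ _)
    obtain ⟨V, k, hV, hpV, hk, hkact, hkdiv⟩ := π.principal.exists_coord (Set.mem_univ (π.proj p))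
    have hπs : ∀ q, π.proj q ∈ U → π.proj (E.σ (s (π.proj q))) = π.proj q := fun q hq => by
      rw [E.proj_σ, (hs' _ ⟨Set.mem_univ _, hq⟩).1]
    -- the difference between the point and the chosen section
    let d : P → C := fun q => (k (E.σ (s (π.proj q))))⁻¹ * k q
    let O : Set P := π.proj ⁻¹' (U ∩ V)
    have hO : IsOpen O := (hU.inter hV).preimage π.principal.smooth_proj.continuous
    have hsO : ContMDiffOn P.I R.I ∞ (fun q => s (π.proj q)) O :=
      hs.comp π.principal.smooth_proj.contMDiffOn fun q hq => hq.1
    have hd : ContMDiffOn P.I 𝓘(ℝ, EC) ∞ d O := by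
      refine ContMDiffOn.mul (I := 𝓘(ℝ, EC)) (ContMDiffOn.inv (I := 𝓘(ℝ, EC)) ?_)
        (hk.mono fun q hq => hq.2)
      refine hk.comp (E.smooth_σ.comp_contMDiffOn hsO) fun q hq => ?_
      change π.proj (E.σ (s (π.proj q))) ∈ V
      rw [hπs q hq.1]
      exact hq.2
    have hdact : ∀ q ∈ O, π.act (E.σ (s (π.proj q))) (d q) = q := fun q hq =>
      hkdiv _ _ (by rw [hπs q hq.1]; exact hq.2) (hπs q hq.1)
    -- Applying `σ` to `s (ρ r) · h r = r` shows that `β (h r)` also carries `σ (s (ρ r))` to `σ r`;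
    -- the action of `C` is free.
    have hdσ : ∀ r, E.σ r ∈ O → d (E.σ r) = β (h r) := by
      intro r hr
      have hrU : E.bundle.proj r ∈ U := by rw [← E.proj_σ]; exact hr.1
      have h₁ := congrArg E.σ (hsh r hrU)
      rw [E.σ_act, ← E.proj_σ] at h₁
      refine π.principal.act_right_injective (E.σ (s (π.proj (E.σ r)))) ?_
      rw [hdact _ hr, h₁]
    obtain ⟨W, sβ, l, hW, hpW, hsβ, hl, hsβ', hsl⟩ :=
      hext.principal.locTriv (d p) (Set.mem_univ _)
    refine ⟨O ∩ d ⁻¹' W, fun q => E.bundle.act (s (π.proj q)) (sβ (d q)), fun r => l (h r),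
      hd.continuousOn.isOpen_inter_preimage hO hW, ⟨⟨hpU, hpV⟩, hpW⟩, ?_, ?_, ?_, ?_⟩
    · exact E.bundle.smooth_act.comp_contMDiffOn ((hsO.mono Set.inter_subset_left).prodMk
        (hsβ.comp (hd.mono Set.inter_subset_left) fun q hq => hq.2))
    · refine hl.comp (hh.mono fun r hr => ?_) fun r hr => ?_
      · change E.bundle.proj r ∈ U
        rw [← E.proj_σ]
        exact hr.1.1
      · change β (h r) ∈ W
        rw [← hdσ r hr.1]
        exact hr.2
    · rintro q ⟨-, hqO, hqW⟩
      have hβd := (hsβ' (d q) ⟨Set.mem_univ _, hqW⟩)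
      refine ⟨?_, fun a => ?_⟩
      · rw [E.σ_act, hβd.1, hdact q hqO]
      · change l (h (E.bundle.act (E.bundle.act (s (π.proj q)) (sβ (d q))) (α a))) = a
        rw [← E.bundle.principal.act_mul, (hs' _ ⟨Set.mem_univ _, hqO.1⟩).2]
        exact hβd.2 a
    · rintro r ⟨hrO, hrW⟩
      have hrU : E.bundle.proj r ∈ U := by rw [← E.proj_σ]; exact hrO.1
      have hdr := hdσ r hrO
      have hW' : β (h r) ∈ W := hdr ▸ hrW
      change E.bundle.act (E.bundle.act (s (π.proj (E.σ r))) (sβ (d (E.σ r)))) (α (l (h r))) = r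
      rw [← E.bundle.principal.act_mul, hdr, E.proj_σ, hsl (h r) hW', hsh r hrU]

/-- The `G`-equivariant principal `A`-bundle `σ : R → P`. -/
def σBundle [LieGroup 𝓘(ℝ, EC) ∞ C] (hext : IsCentralExtension EA EB EC α β) :
    EquivariantBundle P R EA A where
  proj := E.σ
  act r a := E.bundle.act r (α a)
  principal := E.σ_principal hext
  proj_smul := E.σ_smul
  act_smul g r a := E.bundle.act_smul g r (α a)

/-- The connection `t ∘ ω` on `σ : R → P`. -/
def σConnection [LieGroup 𝓘(ℝ, EA) ∞ A] [LieGroup 𝓘(ℝ, EB) ∞ B] [LieGroup 𝓘(ℝ, EC) ∞ C]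
    (hext : IsCentralExtension EA EB EC α β)
    (S : AdSplitting EA EB EC α β) : EquivariantConnection (E.σBundle hext) where
  form := E.connection.form.map S.t
  isConnection := by
    refine ⟨fun r ξ => ?_, fun r a w => ?_⟩
    -- On the orbit of `A`, `ω^ρ` takes the value `α_* ξ`, which `t` sends back to `ξ`.
    · refine (congrArg S.t (E.connection.isConnection.mfderiv_act_hom
        E.bundle.principal.smooth_act E.bundle.principal.act_mul
        (hext.smooth_left.mdifferentiable (by simp) 1) r ξ)).trans ?_
      exact S.retraction_t ξ
    · refine (congrArg S.t (E.connection.isConnection.equivariant r (α a) w)).trans ?_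
      -- `Ad` disappears on both sides: `t` is `Ad`-invariant by the equivariance of the splitting,
      -- and `A` is commutative.
      exact (S.t_Ad hext _ _).trans (Ad_comm _ _).symm
  invariant g r w := congrArg S.t (E.connection.invariant g r w)

/-- The element of the difference bundle given by two points in the same fibre of `R → X`. -/
def diffHom [LieGroup 𝓘(ℝ, EB) ∞ B] (hβ : ContMDiff 𝓘(ℝ, EB) 𝓘(ℝ, EC) ∞ β) (r₁ r₂ : R)
    (h : π.proj (E.σ r₁) = π.proj (E.σ r₂)) : diffManifold hβ π :=
  DiffSpace.mk (E.σ r₁) (E.σ r₂) (E.bundle.principal.div (E.proj_eq_iff.1 h)) (by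
    rw [← E.σ_act, E.bundle.principal.act_div])

theorem act_grp_diffHom [LieGroup 𝓘(ℝ, EB) ∞ B] (hβ : ContMDiff 𝓘(ℝ, EB) 𝓘(ℝ, EC) ∞ β)
    (r₁ r₂ : R) (h : π.proj (E.σ r₁) = π.proj (E.σ r₂)) :
    E.bundle.act r₁ (DiffSpace.grp (E.diffHom hβ r₁ r₂ h)) = r₂ :=
  E.bundle.principal.act_div (E.proj_eq_iff.1 h)

/-- Away from the fibre product, `σ r₂` need not satisfy the equation defining the difference
bundle. The ambient extension replaces it by `σ r₁ · β k`, where `k` extends the division map; the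
two agree on the fibre product. -/
theorem diffHom_smooth [LieGroup 𝓘(ℝ, EB) ∞ B] (hβ : ContMDiff 𝓘(ℝ, EB) 𝓘(ℝ, EC) ∞ β) :
    SmoothOnSubset (R.I.prod R.I) (diffManifold hβ π).I
      (fun z : {z : R × R | π.proj (E.σ z.1) = π.proj (E.σ z.2)} =>
        E.diffHom hβ z.1.1 z.1.2 z.2) := by
  rintro ⟨z, hz⟩
  obtain ⟨U, k, hU, hzU, hk, hk'⟩ := E.bundle.principal.div_smooth ⟨z, E.proj_eq_iff.1 hz⟩
  refine ⟨U, fun y => DiffSpace.mk (E.σ y.1) (π.act (E.σ y.1) (β (k y))) (k y) rfl, hU, hzU,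
    diff_contMDiffOn hβ (E.smooth_σ.comp contMDiff_fst).contMDiffOn hk, fun y hy => ?_⟩
  have h := hk' ⟨y, E.proj_eq_iff.1 y.2⟩ hy
  refine DiffSpace.ext rfl ?_ h
  refine (DiffSpace.eq (E.diffHom hβ y.1.1 y.1.2 y.2)).symm.trans ?_
  exact congrArg (fun b => π.act (E.σ y.1.1) (β b)) h

/-- The trivialization of the lifting gerbe given by a central extension. -/
def toTrivialization [LieGroup 𝓘(ℝ, EA) ∞ A] [LieGroup 𝓘(ℝ, EB) ∞ B] [LieGroup 𝓘(ℝ, EC) ∞ C]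
    (hext : IsCentralExtension EA EB EC α β) (S : AdSplitting EA EB EC α β) :
    ParallelTrivialization (liftingGerbe hext S π) R where
  bundle := E.σBundle hext
  connection := E.σConnection hext S
  hom := E.diffHom hext.smooth_right
  hom_smooth := E.diffHom_smooth hext.smooth_right
  base_hom _ _ _ := rfl
  hom_act r₁ r₂ a b h h' := by
    have hα : ∀ (r : R) (a : A), E.σ (E.bundle.act r (α a)) = E.σ r :=
      (E.σ_principal hext).proj_act
    refine DiffSpace.ext (hα r₁ a) (hα r₂ b) ?_
    refine E.bundle.principal.div_eq (E.proj_eq_iff.1 h') ?_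
    change E.bundle.act (E.bundle.act r₁ (α a))
      (E.bundle.principal.div (E.proj_eq_iff.1 h) * α (a⁻¹ * b)) = E.bundle.act r₂ (α b)
    -- By centrality, `α a * (d * α (a⁻¹ b)) = d * α b`, where `d` carries `r₁` to `r₂`.
    rw [← hext.central, ← E.bundle.principal.act_mul, ← mul_assoc, ← map_mul, mul_inv_cancel_left,
      hext.central, E.bundle.principal.act_mul, E.bundle.principal.act_div]
  hom_smul g r₁ r₂ h h' := DiffSpace.ext (E.σ_smul g r₁) (E.σ_smul g r₂)
    (E.bundle.div_smul g (E.proj_eq_iff.1 h) (E.proj_eq_iff.1 h'))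
  hom_mul r₁ r₂ r₃ h₁₂ h₂₃ h₁₃ h := by
    refine DiffSpace.ext rfl rfl (E.bundle.principal.div_eq (E.proj_eq_iff.1 h₁₃) ?_).symm
    change E.bundle.act r₁ (E.bundle.principal.div (E.proj_eq_iff.1 h₁₂) *
      E.bundle.principal.div (E.proj_eq_iff.1 h₂₃)) = r₃
    rw [E.bundle.principal.act_mul, E.bundle.principal.act_div, E.bundle.principal.act_div]
  parallel c₁ c₂ h hc₁ hc₂ := by
    have h' : ∀ t, π.proj (E.σ (c₁ t)) = π.proj (E.σ (c₂ t)) := h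
    have hq : ContMDiffAt 𝓘(ℝ, ℝ) (diffManifold hext.smooth_right π).I ∞
        (fun t => E.diffHom hext.smooth_right (c₁ t) (c₂ t) (h' t)) 0 :=
      (E.diffHom_smooth hext.smooth_right).contMDiffAt (hc₁.prodMk hc₂)
        (Filter.Eventually.of_forall fun t => ⟨h' t, rfl⟩)
    have hb : MDifferentiableAt 𝓘(ℝ, ℝ) 𝓘(ℝ, EB)
        (fun t => DiffSpace.grp (E.diffHom hext.smooth_right (c₁ t) (c₂ t) (h' t))) 0 :=
      (((diff_smooth_grp hext.smooth_right).contMDiffAt.comp (0 : ℝ) hq)).mdifferentiableAt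
        (by simp)
    -- Here `c₂ = c₁ · b`, with `b` the `B`-component of `ψ[c₁, c₂]`. In the product rule `ω(c₂') =
    -- Ad_{b⁻¹} ω(c₁') + b⁻¹ b'`, applying `t` removes `Ad`, so the difference of the two values of
    -- `t ω` is `t (b⁻¹ b')`, the connection of `Q_P`.
    have e₁ := E.connection.along_act (hc₁.mdifferentiableAt (by simp)) hb
    have e₂ : (fun t => E.bundle.act (c₁ t)
        (DiffSpace.grp (E.diffHom hext.smooth_right (c₁ t) (c₂ t) (h' t)))) = c₂ :=
      funext fun t => E.act_grp_diffHom hext.smooth_right _ _ _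
    have e₃ := (congrArg (fun c : ℝ → R => (E.connection.form.along c : EB)) e₂).symm.trans e₁
    have e₄ := (congrArg (fun ξ : EB => (S.t ξ : EA)) e₃).trans (map_add S.t _ _)
    have e₅ := diffForm_along hext.smooth_right S (hq.mdifferentiableAt (by simp))
    refine e₅.trans (eq_sub_of_add_eq' (Eq.symm ?_))
    refine e₄.trans ?_
    exact congrArg₂ (fun x y : EA => x + y) (S.t_Ad hext _ _) rfl

end AdmissibleExtension

end Forward

end

end LiftingGerbe

namespace LiftingGerbe

noncomputable section

/-! ### From trivializations to central extensions -/

section Backward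

variable {EG : Type*} [NormedAddCommGroup EG] [NormedSpace ℝ EG]
  {G : Type*} [TopologicalSpace G] [ChartedSpace EG G] [Group G]
  {EA : Type*} [NormedAddCommGroup EA] [NormedSpace ℝ EA]
  {A : Type*} [TopologicalSpace A] [ChartedSpace EA A] [CommGroup A] [LieGroup 𝓘(ℝ, EA) ∞ A]
  {EB : Type*} [NormedAddCommGroup EB] [NormedSpace ℝ EB]
  {B : Type*} [TopologicalSpace B] [ChartedSpace EB B] [Group B] [LieGroup 𝓘(ℝ, EB) ∞ B]
  {EC : Type*} [NormedAddCommGroup EC] [NormedSpace ℝ EC]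
  {C : Type*} [TopologicalSpace C] [ChartedSpace EC C] [Group C] [LieGroup 𝓘(ℝ, EC) ∞ C]
  {X : GManifold.{u₁, v₁} EG G} {P : GManifold.{u₂, v₂} EG G}
  {α : A →* B} {β : B →* C} {hext : IsCentralExtension EA EB EC α β}
  {S : AdSplitting EA EB EC α β} {π : EquivariantBundle X P EC C}
  {R : GManifold.{u, v} EG G}

namespace ParallelTrivialization

variable (T : ParallelTrivialization (liftingGerbe hext S π) R)

/-- The principal `A`-bundle `R → P` underlying a trivialization of the lifting gerbe. -/
def liftBundle : EquivariantBundle P R EA A := T.bundle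

/-- The connection on the principal `A`-bundle `R → P`. -/
def liftConnection : EquivariantConnection T.liftBundle := T.connection

/-- The projection `R → P`. -/
def toBase (r : R) : P := T.liftBundle.proj r

theorem toBase_smooth : ContMDiff R.I P.I ∞ T.toBase :=
  T.liftBundle.principal.smooth_proj

/-- The isomorphism `R ×^A R → Q`, with values in the difference bundle. -/
def liftHom (r₁ r₂ : R) (h : π.proj (T.toBase r₁) = π.proj (T.toBase r₂)) :
    diffManifold hext.smooth_right π :=
  T.hom r₁ r₂ h

theorem liftHom_smooth : SmoothOnSubset (R.I.prod R.I) (diffManifold hext.smooth_right π).I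
    (fun z : {z : R × R | π.proj (T.toBase z.1) = π.proj (T.toBase z.2)} =>
      T.liftHom z.1.1 z.1.2 z.2) :=
  T.hom_smooth

/-! ### The `B`-valued difference cocycle of a trivialization -/

open Classical in
/-- The `B`-component of the isomorphism `R ×^A R → Q` (with value `1` on pairs of points that are
not in the same fibre over `X`). -/
def diff (r₁ r₂ : R) : B :=
  if h : π.proj (T.toBase r₁) = π.proj (T.toBase r₂) then DiffSpace.grp (T.liftHom r₁ r₂ h) else 1

variable {T} {r₁ r₂ r₃ : R}

theorem grp_hom (h : π.proj (T.toBase r₁) = π.proj (T.toBase r₂)) :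
    DiffSpace.grp (T.liftHom r₁ r₂ h) = T.diff r₁ r₂ := by
  rw [diff, dif_pos h]

/-- This is the defining equation of a triple in `Q_P`, whose first two entries are identified by
`base_hom`. -/
theorem act_diff (h : π.proj (T.toBase r₁) = π.proj (T.toBase r₂)) :
    π.act (T.toBase r₁) (β (T.diff r₁ r₂)) = T.toBase r₂ := by
  have hb := T.base_hom r₁ r₂ h
  have h₁ : DiffSpace.fst (T.liftHom r₁ r₂ h) = T.toBase r₁ := congrArg Prod.fst hb
  have h₂ : DiffSpace.snd (T.liftHom r₁ r₂ h) = T.toBase r₂ := congrArg Prod.snd hb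
  have h₃ := DiffSpace.eq (T.liftHom r₁ r₂ h)
  rwa [h₁, h₂, grp_hom] at h₃

/-- The cocycle identity is the `B`-component of the compatibility of `ψ` with the multiplication of
the gerbe. -/
theorem diff_mul_diff (h₁₂ : π.proj (T.toBase r₁) = π.proj (T.toBase r₂))
    (h₂₃ : π.proj (T.toBase r₂) = π.proj (T.toBase r₃)) :
    T.diff r₁ r₂ * T.diff r₂ r₃ = T.diff r₁ r₃ := by
  have h := congrArg DiffSpace.grp (T.hom_mul r₁ r₂ r₃ h₁₂ h₂₃ (h₁₂.trans h₂₃)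
    ((congrArg Prod.snd (T.base_hom r₁ r₂ h₁₂)).trans
      (congrArg Prod.fst (T.base_hom r₂ r₃ h₂₃)).symm))
  rw [← grp_hom h₁₂, ← grp_hom h₂₃, ← grp_hom (h₁₂.trans h₂₃)]
  exact h

/-- By the cocycle identity this element is idempotent, and a group has only one idempotent. -/
theorem diff_self (r : R) : T.diff r r = 1 :=
  mul_eq_left.1 (diff_mul_diff (T := T) (r₁ := r) rfl rfl)

theorem toBase_act (r : R) (a : A) : T.toBase (T.liftBundle.act r a) = T.toBase r :=
  T.liftBundle.principal.proj_act r a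

theorem diff_act (h : π.proj (T.toBase r₁) = π.proj (T.toBase r₂)) (a : A) :
    T.diff r₁ (T.liftBundle.act r₂ a) = T.diff r₁ r₂ * α a := by
  have h' : π.proj (T.toBase r₁) = π.proj (T.toBase (T.liftBundle.act r₂ a)) := by
    rw [toBase_act, h]
  -- `hom_act` moves both arguments; letting `1` act on the first isolates the effect on the second.
  have h'' : π.proj (T.toBase (T.liftBundle.act r₁ 1)) =
      π.proj (T.toBase (T.liftBundle.act r₂ a)) := by
    rw [toBase_act, toBase_act, h]
  have e := congrArg DiffSpace.grp (T.hom_act r₁ r₂ 1 a h h'')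
  have e' : T.diff (T.liftBundle.act r₁ 1) (T.liftBundle.act r₂ a) =
      T.diff r₁ r₂ * α (1⁻¹ * a) := by
    rw [← grp_hom h, ← grp_hom h'']
    exact e
  rwa [T.liftBundle.principal.act_one, inv_one, one_mul] at e'

theorem toBase_smul (g : G) (r : R) : T.toBase (g • r) = g • T.toBase r :=
  T.liftBundle.proj_smul g r

theorem diff_smul (g : G) (h : π.proj (T.toBase r₁) = π.proj (T.toBase r₂)) :
    T.diff (g • r₁) (g • r₂) = T.diff r₁ r₂ := by
  have h' : π.proj (T.toBase (g • r₁)) = π.proj (T.toBase (g • r₂)) := by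
    rw [toBase_smul, toBase_smul, π.proj_smul, π.proj_smul, h]
  rw [← grp_hom h, ← grp_hom h']
  have e : T.liftHom (g • r₁) (g • r₂) h' = g • T.liftHom r₁ r₂ h := T.hom_smul g r₁ r₂ h h'
  rw [e]
  rfl

/-- The cocycle has a meaning only on the fibre product over `X`, and off it `diff` is extended by
`1`. Hence the pair is required to stay in the fibre product near `x`. -/
theorem diff_smooth {E H F : Type*} [NormedAddCommGroup E] [NormedSpace ℝ E] [TopologicalSpace H]
    {I : ModelWithCorners ℝ E H} [TopologicalSpace F] [ChartedSpace H F] {f₁ f₂ : F → R} {x : F}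
    (h₁ : ContMDiffAt I R.I ∞ f₁ x) (h₂ : ContMDiffAt I R.I ∞ f₂ x)
    (h : ∀ᶠ y in 𝓝 x, π.proj (T.toBase (f₁ y)) = π.proj (T.toBase (f₂ y))) :
    ContMDiffAt I 𝓘(ℝ, EB) ∞ (fun y => T.diff (f₁ y) (f₂ y)) x := by
  have hs' : SmoothOnSubset (R.I.prod R.I) 𝓘(ℝ, EB)
      (fun z : {z : R × R | π.proj (T.toBase z.1) = π.proj (T.toBase z.2)} =>
        T.diff z.1.1 z.1.2) := by
    intro z
    obtain ⟨U, g, hU, hz, hg, hg'⟩ := T.liftHom_smooth z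
    refine ⟨U, fun y => DiffSpace.grp (g y), hU, hz,
      (diff_smooth_grp hext.smooth_right).comp_contMDiffOn hg, fun y hy => ?_⟩
    exact (grp_hom y.2).symm.trans (congrArg DiffSpace.grp (hg' y hy))
  exact hs'.contMDiffAt (h₁.prodMk h₂) (h.mono fun y hy => ⟨hy, rfl⟩)

/-- This makes the future `B`-action single-valued. Equal differences force `r₂` and `r₃` over the
same point of `P`, hence `r₃ = r₂ a`; then `α a = 1`, so `a = 1`. -/
theorem eq_of_diff_eq (h₂ : π.proj (T.toBase r₁) = π.proj (T.toBase r₂))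
    (h₃ : π.proj (T.toBase r₁) = π.proj (T.toBase r₃)) (h : T.diff r₁ r₂ = T.diff r₁ r₃) :
    r₂ = r₃ := by
  have hb : T.toBase r₂ = T.toBase r₃ := by rw [← act_diff h₂, ← act_diff h₃, h]
  obtain ⟨a, rfl⟩ := T.liftBundle.principal.exists_act_eq hb
  rw [diff_act h₂, left_eq_mul, ← map_one α] at h
  rw [hext.injective h, T.liftBundle.principal.act_one]

variable (T) in
-- Any point `r'` of `R` over `σ(r) · β b` has a difference from `r` with the same image in `C` as
-- `b`. By exactness it is off by some `α a`, and moving `r'` by `a` corrects it.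
theorem exists_diff_eq (r : R) (b : B) :
    ∃ r', π.proj (T.toBase r) = π.proj (T.toBase r') ∧ T.diff r r' = b := by
  obtain ⟨r', hr'⟩ := T.liftBundle.principal.exists_proj_eq
    (Set.mem_univ (π.act (T.toBase r) (β b)))
  have hr : T.toBase r' = π.act (T.toBase r) (β b) := hr'
  have h : π.proj (T.toBase r) = π.proj (T.toBase r') := by
    rw [hr, π.principal.proj_act]
  have hβ : β (T.diff r r') = β b :=
    π.principal.act_right_injective (T.toBase r) ((act_diff h).trans hr)
  obtain ⟨a, ha⟩ := (hext.mem_ker ((T.diff r r')⁻¹ * b)).1 (by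
    rw [map_mul, map_inv, hβ, inv_mul_cancel])
  refine ⟨T.liftBundle.act r' a, by rw [toBase_act, h], ?_⟩
  rw [diff_act h, ha, mul_inv_cancel_left]

/-! ### The `B`-action and the principal `B`-bundle over `X` -/

variable (T) in
/-- The action of `B` on the total space of a trivialization: `r b` is the point `r'` with
`ψ[r, r'] = (σ r, σ r', b)`. -/
def liftAct (r : R) (b : B) : R := (T.exists_diff_eq r b).choose

theorem proj_liftAct (r : R) (b : B) :
    π.proj (T.toBase r) = π.proj (T.toBase (T.liftAct r b)) :=
  (T.exists_diff_eq r b).choose_spec.1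

theorem diff_liftAct (r : R) (b : B) : T.diff r (T.liftAct r b) = b :=
  (T.exists_diff_eq r b).choose_spec.2

theorem liftAct_eq {b : B} (h : π.proj (T.toBase r₁) = π.proj (T.toBase r₂))
    (hb : T.diff r₁ r₂ = b) : T.liftAct r₁ b = r₂ :=
  eq_of_diff_eq (proj_liftAct r₁ b) h ((diff_liftAct r₁ b).trans hb.symm)

theorem liftAct_diff (h : π.proj (T.toBase r₁) = π.proj (T.toBase r₂)) :
    T.liftAct r₁ (T.diff r₁ r₂) = r₂ :=
  liftAct_eq h rfl

theorem toBase_liftAct (r : R) (b : B) :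
    T.toBase (T.liftAct r b) = π.act (T.toBase r) (β b) := by
  rw [← act_diff (proj_liftAct r b), diff_liftAct]

theorem liftAct_left (r : R) (a : A) : T.liftAct r (α a) = T.liftBundle.act r a := by
  refine liftAct_eq (by rw [toBase_act]) ?_
  rw [diff_act rfl, diff_self, one_mul]

variable (T) in
-- The point `r b` lies over `f (r, b) = σ(r) · β b`. A local section `s` of `R → P` gives a smooth
-- choice `s (f (r, b))` in the right `A`-orbit, which misses `r b` by the element `d(r, s (f (r,
-- b)))⁻¹ * b` of `α(A)`. A smooth local left inverse of `α` turns this into a correction that is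
-- smooth with values in `A`.
theorem liftAct_smooth :
    ContMDiff (R.I.prod 𝓘(ℝ, EB)) R.I ∞ (fun z : R × B => T.liftAct z.1 z.2) := by
  intro z
  let f : R × B → P := fun y => π.act (T.toBase y.1) (β y.2)
  have hf : ContMDiff (R.I.prod 𝓘(ℝ, EB)) P.I ∞ f := π.principal.smooth_act.comp
    ((T.toBase_smooth.comp contMDiff_fst).prodMk (hext.smooth_right.comp contMDiff_snd))
  obtain ⟨U, s, _, hU, hzU, hs, -, hs', -⟩ :=
    T.liftBundle.principal.locTriv (f z) (Set.mem_univ _)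
  have hsf : ContMDiffAt (R.I.prod 𝓘(ℝ, EB)) R.I ∞ (fun y => s (f y)) z :=
    (hs.contMDiffAt (hU.mem_nhds hzU)).comp z hf.contMDiffAt
  have hev : ∀ᶠ y in 𝓝 z, f y ∈ U :=
    hf.continuous.continuousAt.preimage_mem_nhds (hU.mem_nhds hzU)
  have hbase : ∀ y, f y ∈ U → T.toBase (s (f y)) = f y := fun y hy =>
    (hs' _ ⟨Set.mem_univ _, hy⟩).1
  have hfib : ∀ y, f y ∈ U → π.proj (T.toBase y.1) = π.proj (T.toBase (s (f y))) := fun y hy => by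
    rw [hbase y hy, π.principal.proj_act]
  have hd : ContMDiffAt (R.I.prod 𝓘(ℝ, EB)) 𝓘(ℝ, EB) ∞
      (fun y : R × B => T.diff y.1 (s (f y))) z :=
    diff_smooth contMDiffAt_fst hsf (hev.mono hfib)
  have hk : ContMDiffAt (R.I.prod 𝓘(ℝ, EB)) 𝓘(ℝ, EB) ∞
      (fun y : R × B => (T.diff y.1 (s (f y)))⁻¹ * y.2) z :=
    ContMDiffAt.mul (I := 𝓘(ℝ, EB)) (ContMDiffAt.inv (I := 𝓘(ℝ, EB)) hd) contMDiffAt_snd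
  have hker : ∀ y, f y ∈ U → ∃ a, α a = (T.diff y.1 (s (f y)))⁻¹ * y.2 := by
    intro y hy
    refine (hext.mem_ker _).1 ?_
    have : β (T.diff y.1 (s (f y))) = β y.2 :=
      π.principal.act_right_injective (T.toBase y.1) ((act_diff (hfib y hy)).trans (hbase y hy))
    rw [map_mul, map_inv, this, inv_mul_cancel]
  obtain ⟨W, l, hW, hαW, hl, hlα⟩ := hext.exists_leftInverse
  have hzW : (T.diff z.1 (s (f z)))⁻¹ * z.2 ∈ W := by
    obtain ⟨a, ha⟩ := hker z hzU
    exact ha ▸ hαW a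
  have hlk : ContMDiffAt (R.I.prod 𝓘(ℝ, EB)) 𝓘(ℝ, EA) ∞
      (fun y : R × B => l ((T.diff y.1 (s (f y)))⁻¹ * y.2)) z :=
    ContMDiffAt.comp z (hl.contMDiffAt (hW.mem_nhds hzW)) hk
  have hact : ContMDiffAt (R.I.prod 𝓘(ℝ, EB)) R.I ∞
      (fun y : R × B => T.liftBundle.act (s (f y)) (l ((T.diff y.1 (s (f y)))⁻¹ * y.2))) z :=
    T.liftBundle.principal.smooth_act.contMDiffAt.comp z (hsf.prodMk hlk)
  refine hact.congr_of_eventuallyEq ?_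
  filter_upwards [hev] with y hy
  obtain ⟨a, ha⟩ := hker y hy
  refine liftAct_eq (by rw [toBase_act, hfib y hy]) ?_
  rw [← ha, hlα, diff_act (hfib y hy), ha, mul_inv_cancel_left]

variable (T) in
-- Local sections of `P → X` and `R → P` compose to a local section of `R → X`, and the
-- `B`-coordinate of `r` is its difference from that section. Associativity of the action is the
-- cocycle identity.
theorem lift_principal :
    IsPrincipalBundle X.I R.I EB Set.univ (fun r => π.proj (T.toBase r)) T.liftAct where
  smooth_proj := π.principal.smooth_proj.comp T.toBase_smooth
  proj_mem _ := Set.mem_univ _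
  smooth_act := T.liftAct_smooth
  act_one r := liftAct_eq rfl (diff_self r)
  act_mul r k l := liftAct_eq ((proj_liftAct r k).trans (proj_liftAct _ l)) (by
    rw [← diff_mul_diff (proj_liftAct r k) (proj_liftAct _ l), diff_liftAct, diff_liftAct])
  proj_act r b := (proj_liftAct r b).symm
  locTriv := by
    intro x _
    obtain ⟨U, s, _, hU, hxU, hs, -, hs', -⟩ := π.principal.locTriv x (Set.mem_univ _)
    obtain ⟨V, k, _, hV, hxV, hk, -, hk', -⟩ :=
      T.liftBundle.principal.locTriv (s x) (Set.mem_univ _)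
    let O : Set X := U ∩ s ⁻¹' V
    have hO : IsOpen O := hs.continuousOn.isOpen_inter_preimage hU hV
    have hks : ContMDiffOn X.I R.I ∞ (fun y => k (s y)) O :=
      hk.comp (hs.mono Set.inter_subset_left) fun y hy => hy.2
    have hproj : ∀ y ∈ O, π.proj (T.toBase (k (s y))) = y := by
      intro y hy
      have h : T.toBase (k (s y)) = s y := (hk' (s y) ⟨Set.mem_univ _, hy.2⟩).1
      rw [h, (hs' y ⟨Set.mem_univ _, hy.1⟩).1]
    have hcont : ContMDiff R.I X.I ∞ fun r => π.proj (T.toBase r) :=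
      π.principal.smooth_proj.comp T.toBase_smooth
    refine ⟨O, fun y => k (s y), fun r => T.diff (k (s (π.proj (T.toBase r)))) r, hO, ⟨hxU, hxV⟩,
      hks, ?_, ?_, ?_⟩
    · intro r hr
      have hr' : O ∈ 𝓝 (π.proj (T.toBase r)) := hO.mem_nhds hr
      refine ContMDiffAt.contMDiffWithinAt ?_
      have hkr : ContMDiffAt R.I R.I ∞ (fun r => k (s (π.proj (T.toBase r)))) r :=
        ContMDiffAt.comp (g := fun y => k (s y)) r (hks.contMDiffAt hr') hcont.contMDiffAt
      refine diff_smooth hkr contMDiffAt_id ?_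
      filter_upwards [hcont.continuous.continuousAt.preimage_mem_nhds hr'] with r' hr'
      exact hproj _ hr'
    · rintro y ⟨-, hy⟩
      refine ⟨hproj y hy, fun b => ?_⟩
      change T.diff (k (s (π.proj (T.toBase (T.liftAct (k (s y)) b))))) (T.liftAct (k (s y)) b) = b
      rw [← proj_liftAct, hproj y hy, diff_liftAct]
    · intro r hr
      exact liftAct_diff (hproj _ hr)

variable (T) in
/-- The `G`-equivariant principal `B`-bundle `R → X`. -/
def extensionBundle : EquivariantBundle X R EB B where
  proj r := π.proj (T.toBase r)
  act := T.liftAct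
  principal := T.lift_principal
  proj_smul g r := by rw [toBase_smul, π.proj_smul]
  act_smul g r b := by
    have h := proj_liftAct (T := T) r b
    refine liftAct_eq ?_ ?_
    · rw [toBase_smul, toBase_smul, π.proj_smul, π.proj_smul, h]
    · rw [diff_smul g h, diff_liftAct]

/-! ### The connection on the `B`-bundle -/

/-- The connection on `R → P` on velocities of curves multiplied by curves in `B`. -/
theorem along_liftAct {c : ℝ → R} {b : ℝ → B} (hc : ContMDiffAt 𝓘(ℝ, ℝ) R.I ∞ c 0)
    (hb : ContMDiffAt 𝓘(ℝ, ℝ) 𝓘(ℝ, EB) ∞ b 0) :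
    T.liftConnection.form.along (fun t => T.liftAct (c t) (b t)) =
      T.liftConnection.form.along c +
        S.t (maurerCartan EB (b 0) (mfderiv 𝓘(ℝ, ℝ) 𝓘(ℝ, EB) b 0 (1 : ℝ))) := by
  have hcb : ContMDiffAt 𝓘(ℝ, ℝ) R.I ∞ (fun t => T.liftAct (c t) (b t)) 0 :=
    T.liftAct_smooth.contMDiffAt.comp (0 : ℝ) (hc.prodMk hb)
  have hfib : ∀ t, π.proj (T.toBase (c t)) = π.proj (T.toBase (T.liftAct (c t) (b t))) :=
    fun t => proj_liftAct _ _
  -- Parallelism of `ψ` is applied to the pair `(c, c · b)`: the `B`-component of `ψ[c, c · b]` is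
  -- the curve `b` itself.
  have e := T.parallel c _ hfib hc hcb
  have hq : ContMDiffAt 𝓘(ℝ, ℝ) (diffManifold hext.smooth_right π).I ∞
      (fun t => T.liftHom (c t) (T.liftAct (c t) (b t)) (hfib t)) 0 :=
    T.liftHom_smooth.contMDiffAt (hc.prodMk hcb) (Filter.Eventually.of_forall fun t => ⟨hfib t, rfl⟩)
  have e' := diffForm_along hext.smooth_right S (hq.mdifferentiableAt (by simp))
  have hgrp : (fun t => DiffSpace.grp (T.liftHom (c t) (T.liftAct (c t) (b t)) (hfib t))) = b :=
    funext fun t => (grp_hom (hfib t)).trans (diff_liftAct _ _)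
  have e'' := congrArg (fun b : ℝ → B =>
    (S.t (maurerCartan EB (b 0) (mfderiv 𝓘(ℝ, ℝ) 𝓘(ℝ, EB) b 0 (1 : ℝ))) : EA)) hgrp
  exact sub_eq_iff_eq_add'.1 (e.symm.trans (e'.trans e''))

/-- This is the product rule for a constant curve in `R` and a curve in `B` through `1` with
velocity `ξ`. -/
theorem liftConnection_vertical (r : R) (ξ : LieAlg EB B) :
    @Eq EA (T.liftConnection.form.toFun (T.liftAct r 1)
      (mfderiv 𝓘(ℝ, EB) R.I (T.liftAct r) 1 ξ)) (S.t ξ) := by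
  obtain ⟨c, hc0, hc, hw⟩ := exists_curve (I := 𝓘(ℝ, EB)) (1 : B) ξ
  have e := T.liftConnection.form.along_comp hc0 (hc.mdifferentiableAt (by simp)) hw
    ((T.lift_principal.act_smooth_right r).mdifferentiable (by simp) 1)
  refine e.symm.trans ((along_liftAct contMDiffAt_const hc).trans ?_)
  refine (congrArg₂ (fun x y : EA => x + y) (T.liftConnection.form.along_const r)
    (congrArg (fun x : EB => (S.t x : EA)) ?_)).trans (zero_add _)
  exact (maurerCartan_one_apply (EB := EB) (B := B) _ (c 0) hc0).trans hw

/-- This is the product rule for a curve in `R` and a constant in `B`. No `Ad` appears because only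
the `A`-component of a connection is involved. -/
theorem liftConnection_equivariant (r : R) (b : B) (w : TangentSpace R.I r) :
    @Eq EA (T.liftConnection.form.toFun (T.liftAct r b)
      (mfderiv R.I R.I (fun q => T.liftAct q b) r w)) (T.liftConnection.form.toFun r w) := by
  obtain ⟨c, hc0, hc, hw⟩ := exists_curve (I := R.I) r w
  have e := T.liftConnection.form.along_comp hc0 (hc.mdifferentiableAt (by simp)) hw
    ((T.lift_principal.act_smooth_left b).mdifferentiable (by simp) r)
  refine e.symm.trans ((along_liftAct hc contMDiffAt_const).trans ?_)
  refine (congrArg₂ (fun x y : EA => x + y) (T.liftConnection.form.along_eq hc0 hw)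
    ((congrArg (fun x : EB => (S.t x : EA))
      (maurerCartan_const (EB := EB) (0 : ℝ) b (1 : ℝ))).trans (map_zero S.t))).trans (add_zero _)

variable (T) in
/-- The connection `α_* ω^σ + s (σ^* ω^π)` on the principal `B`-bundle `R → X`. -/
def extensionForm (ηπ : EquivariantConnection π) : OneForm R.toSmoothManifold EB B :=
  T.liftConnection.form.map (lieMap EA EB α) + (ηπ.form.pullback T.toBase T.toBase_smooth).map S.s

theorem extensionForm_apply (ηπ : EquivariantConnection π) (r : R) (w : TangentSpace R.I r) :
    (T.extensionForm ηπ).toFun r w = lieMap EA EB α (T.liftConnection.form.toFun r w) +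
      S.s ((ηπ.form.pullback T.toBase T.toBase_smooth).toFun r w) :=
  rfl

theorem lieMap_extensionForm (ηπ : EquivariantConnection π) (r : R) (w : TangentSpace R.I r) :
    lieMap EB EC β ((T.extensionForm ηπ).toFun r w) =
      ηπ.form.toFun (T.toBase r) (mfderiv R.I P.I T.toBase r w) := by
  rw [extensionForm_apply, map_add, hext.lieMap_lieMap, zero_add, S.section_s]
  rfl

theorem t_extensionForm (ηπ : EquivariantConnection π) (r : R) (w : TangentSpace R.I r) :
    S.t ((T.extensionForm ηπ).toFun r w) = T.liftConnection.form.toFun r w := by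
  rw [extensionForm_apply, map_add, S.retraction_t, S.t_s, add_zero]

variable (T) in
/-- The connection `α_* ω^σ + s (σ^* ω^π)` on the principal `B`-bundle `R → X`. -/
def extensionConnection (ηπ : EquivariantConnection π) :
    EquivariantConnection T.extensionBundle where
  form := T.extensionForm ηπ
  isConnection := by
    refine ⟨fun r ξ => ?_, fun r b w => ?_⟩
    · have h₁ := liftConnection_vertical (T := T) r ξ
      have h₂ := ηπ.form.pullback_mfderiv T.toBase_smooth
        ((T.lift_principal.act_smooth_right r).mdifferentiable (by simp) 1) ξ
      have h₃ := ηπ.form.toFun_mfderiv_congr (I := 𝓘(ℝ, EB)) (toBase_liftAct (T := T) r) 1 ξ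
      have h₄ := ηπ.isConnection.mfderiv_act_hom π.principal.smooth_act π.principal.act_mul
        (hext.smooth_right.mdifferentiable (by simp) 1) (T.toBase r) ξ
      -- On the vertical vector of `ξ`, `ω^σ` gives `t ξ`, and `σ^* ω^π` gives `β_* ξ` because `σ(r
      -- b) = σ(r) · β b`. The splitting reassembles these two components into `ξ`.
      refine Eq.trans ?_ (S.add_eq ξ)
      exact congrArg₂ (fun (x : EA) (y : EC) => (lieMap EA EB α x + S.s y : EB)) h₁
        (h₂.trans (h₃.trans h₄))
    · have h₁ := liftConnection_equivariant (T := T) r b w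
      have h₂ := ηπ.form.pullback_mfderiv T.toBase_smooth
        ((T.lift_principal.act_smooth_left b).mdifferentiable (by simp) r) w
      have h₃ := ηπ.form.toFun_mfderiv_congr (I := R.I) (fun q => toBase_liftAct (T := T) q b) r w
      have h₄ : @Eq P.E (mfderiv R.I P.I (fun q => π.act (T.toBase q) (β b)) r w)
          (mfderiv P.I P.I (fun p => π.act p (β b)) (T.toBase r)
            (mfderiv R.I P.I T.toBase r w)) :=
        mfderiv_comp_apply (I := R.I) (I' := P.I) (I'' := P.I) r
          (g := fun p => π.act p (β b)) (f := T.toBase)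
          ((π.principal.act_smooth_left (β b)).mdifferentiable (by simp) _)
          (T.toBase_smooth.mdifferentiable (by simp) r) w
      have h₅ := congrArg (fun w : P.E => (ηπ.form.toFun (π.act (T.toBase r) (β b)) w : EC)) h₄
      have h₆ := ηπ.isConnection.equivariant (T.toBase r) (β b) (mfderiv R.I P.I T.toBase r w)
      refine (congrArg₂ (fun (x : EA) (y : EC) => (lieMap EA EB α x + S.s y : EB)) h₁
        (h₂.trans (h₃.trans (h₅.trans h₆)))).trans ?_
      -- `Ad` is compatible with the two summands separately: it fixes the image of `α_*` by
      -- centrality, and `s` intertwines it with `Ad` on the Lie algebra of `C`.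
      refine Eq.trans ?_ (map_add (Ad EB b⁻¹) _ _).symm
      refine congrArg₂ (fun x y : EB => x + y) (Ad_lieMap hext _ _).symm ?_
      refine Eq.trans ?_ (S.equivariant b⁻¹ _)
      rw [map_inv]
      rfl
  invariant g r w := by
    have h₁ := T.liftConnection.invariant g r w
    have h₂ := ηπ.form.pullback_mfderiv T.toBase_smooth (R.mdifferentiable_smul g r) w
    have h₃ := ηπ.form.toFun_mfderiv_congr (I := R.I) (toBase_smul (T := T) g) r w
    have h₄ : @Eq P.E (mfderiv R.I P.I (fun q => g • T.toBase q) r w)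
        (mfderiv P.I P.I (fun p : P => g • p) (T.toBase r) (mfderiv R.I P.I T.toBase r w)) :=
      mfderiv_comp_apply (I := R.I) (I' := P.I) (I'' := P.I) r
        (g := fun p : P => g • p) (f := T.toBase) (P.mdifferentiable_smul g _)
        (T.toBase_smooth.mdifferentiable (by simp) r) w
    have h₅ := congrArg (fun w : P.E => (ηπ.form.toFun (g • T.toBase r) w : EC)) h₄
    have h₆ := ηπ.invariant g (T.toBase r) (mfderiv R.I P.I T.toBase r w)
    exact congrArg₂ (fun (x : EA) (y : EC) => (lieMap EA EB α x + S.s y : EB)) h₁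
        (h₂.trans (h₃.trans (h₅.trans h₆)))

variable (T) in
/-- The central extension given by a trivialization of the lifting gerbe. -/
def toExtension (ηπ : EquivariantConnection π) : AdmissibleExtension EB β ηπ R where
  bundle := T.extensionBundle
  σ := T.toBase
  smooth_σ := T.toBase_smooth
  proj_σ _ := rfl
  σ_act := toBase_liftAct
  σ_smul := toBase_smul
  connection := T.extensionConnection ηπ
  admissible := lieMap_extensionForm ηπ

end ParallelTrivialization

end Backward

end

end LiftingGerbe

namespace LiftingGerbe

noncomputable section

/-! ### The correspondence -/

section Correspondence

variable {EG : Type*} [NormedAddCommGroup EG] [NormedSpace ℝ EG]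
  {G : Type*} [TopologicalSpace G] [ChartedSpace EG G] [Group G]
  {EA : Type*} [NormedAddCommGroup EA] [NormedSpace ℝ EA]
  {A : Type*} [TopologicalSpace A] [ChartedSpace EA A] [CommGroup A]
  {EB : Type*} [NormedAddCommGroup EB] [NormedSpace ℝ EB]
  {B : Type*} [TopologicalSpace B] [ChartedSpace EB B] [Group B]
  {EC : Type*} [NormedAddCommGroup EC] [NormedSpace ℝ EC]
  {C : Type*} [TopologicalSpace C] [ChartedSpace EC C] [Group C]
  {X : GManifold.{u₁, v₁} EG G} {P : GManifold.{u₂, v₂} EG G}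
  {α : A →* B} {β : B →* C} {π : EquivariantBundle X P EC C} {ηπ : EquivariantConnection π}

/-- The projection to `X` is `π ∘ σ`, hence is no additional datum; apart from `σ`, the action and
the form, all fields are propositions. -/
theorem AdmissibleExtension.ext_apply {R : GManifold.{u, v} EG G}
    {E E' : AdmissibleExtension EB β ηπ R} (hσ : ∀ r, E.σ r = E'.σ r)
    (hact : ∀ r b, E.bundle.act r b = E'.bundle.act r b)
    (hform : ∀ r (w : TangentSpace R.I r),
      E.connection.form.toFun r w = E'.connection.form.toFun r w) : E = E' := by
  have hproj : E.bundle.proj = E'.bundle.proj := by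
    funext r
    rw [← E.proj_σ, ← E'.proj_σ, hσ]
  obtain ⟨⟨proj, act, _, _, _⟩, σ, _, _, _, _, ⟨⟨form, _⟩, _, _⟩, _⟩ := E
  obtain ⟨⟨proj', act', _, _, _⟩, σ', _, _, _, _, ⟨⟨form', _⟩, _, _⟩, _⟩ := E'
  obtain rfl : proj = proj' := hproj
  obtain rfl : act = act' := funext fun r => funext (hact r)
  obtain rfl : σ = σ' := funext hσ
  obtain rfl : form = form' := funext fun r => ContinuousLinearMap.ext (hform r)
  rfl

theorem ParallelTrivialization.ext_apply {𝒢 : Gerbe.{u₁, v₁, u₂, v₂, u₃, v₃, u₄, v₄} X EA A}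
    {R : GManifold.{u, v} EG G} {T T' : ParallelTrivialization 𝒢 R}
    (hproj : ∀ r, T.bundle.proj r = T'.bundle.proj r)
    (hact : ∀ r a, T.bundle.act r a = T'.bundle.act r a)
    (hform : ∀ r (w : TangentSpace R.I r),
      T.connection.form.toFun r w = T'.connection.form.toFun r w)
    (hhom : ∀ r₁ r₂ h h', T.hom r₁ r₂ h = T'.hom r₁ r₂ h') : T = T' := by
  obtain ⟨⟨proj, act, _, _, _⟩, ⟨⟨form, _⟩, _, _⟩, hom, _, _, _, _, _, _⟩ := T
  obtain ⟨⟨proj', act', _, _, _⟩, ⟨⟨form', _⟩, _, _⟩, hom', _, _, _, _, _, _⟩ := T'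
  obtain rfl : proj = proj' := funext hproj
  obtain rfl : act = act' := funext fun r => funext (hact r)
  obtain rfl : form = form' := funext fun r => ContinuousLinearMap.ext (hform r)
  obtain rfl : hom = hom' := funext fun r₁ => funext fun r₂ => funext fun h => hhom r₁ r₂ h h
  rfl

variable [LieGroup 𝓘(ℝ, EA) ∞ A] [LieGroup 𝓘(ℝ, EB) ∞ B] [LieGroup 𝓘(ℝ, EC) ∞ C]
  (hext : IsCentralExtension EA EB EC α β) (S : AdSplitting EA EB EC α β)

theorem AdmissibleExtension.diff_toTrivialization {R : GManifold.{u, v} EG G}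
    (E : AdmissibleExtension EB β ηπ R) (r : R) (b : B) :
    (E.toTrivialization hext S).diff r (E.bundle.act r b) = b := by
  have h : π.proj (E.σ r) = π.proj (E.σ (E.bundle.act r b)) :=
    E.proj_eq_iff.2 (E.bundle.principal.proj_act r b).symm
  refine (ParallelTrivialization.grp_hom (T := E.toTrivialization hext S) h).symm.trans ?_
  exact E.bundle.principal.div_eq (E.proj_eq_iff.1 h) rfl

/-- Central extensions with admissible connection on `R` correspond to parallel trivializations of
the lifting gerbe with total space `R`. -/
def extensionEquiv (ηπ : EquivariantConnection π) (R : GManifold.{u, v} EG G) :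
    AdmissibleExtension EB β ηπ R ≃ ParallelTrivialization (liftingGerbe hext S π) R where
  toFun E := E.toTrivialization hext S
  invFun T := T.toExtension ηπ
  left_inv E := by
    refine AdmissibleExtension.ext_apply (fun _ => rfl) (fun r b => ?_) fun r w => ?_
    -- The reconstructed `r b` is characterised by having difference `b` from `r`, and so is the
    -- original one, whose division map was used for `ψ`.
    · refine ParallelTrivialization.liftAct_eq (T := E.toTrivialization hext S) ?_
        (E.diff_toTrivialization hext S r b)
      exact E.proj_eq_iff.2 (E.bundle.principal.proj_act r b).symm
    -- The original and the reconstructed connection have the same `t`-component by construction and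
    -- the same image under `β_*` by admissibility.
    · refine S.ext_iff.2 ⟨?_, ?_⟩
      · exact ParallelTrivialization.t_extensionForm (T := E.toTrivialization hext S) ηπ r w
      · refine (ParallelTrivialization.lieMap_extensionForm
          (T := E.toTrivialization hext S) ηπ r w).trans ?_
        exact (E.admissible r w).symm
  right_inv T := by
    refine ParallelTrivialization.ext_apply (fun _ => rfl)
      (ParallelTrivialization.liftAct_left (T := T))
      (ParallelTrivialization.t_extensionForm (T := T) ηπ) fun r₁ r₂ h h' => ?_
    have h₀ : π.proj (T.toBase r₁) = π.proj (T.toBase r₂) := h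
    have hb := T.base_hom r₁ r₂ h'
    have hd : DiffSpace.grp (T.liftHom r₁ r₂ h₀) = T.diff r₁ r₂ :=
      ParallelTrivialization.grp_hom h₀
    -- The isomorphism `ψ` is determined by its base points and its `B`-component, and the latter is
    -- the division map of the reconstructed action.
    refine DiffSpace.ext (congrArg Prod.fst hb).symm (congrArg Prod.snd hb).symm ?_
    refine Eq.trans ?_ hd.symm
    exact T.lift_principal.div_eq h₀ (ParallelTrivialization.liftAct_diff h₀)

/-- Over `P`, preserving `ψ` means preserving the division map of the `B`-bundles, which amounts to
`B`-equivariance. Of the two components of the connection, the one in the Lie algebra of `C` is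
pulled back from `P` and is therefore preserved by every diffeomorphism over `P`. -/
theorem AdmissibleExtension.isIso_iff {R R' : GManifold.{u, v} EG G}
    (E : AdmissibleExtension EB β ηπ R) (E' : AdmissibleExtension EB β ηπ R')
    (φ : Diffeomorph R.I R'.I R R' ∞) :
    E.IsIso E' φ ↔ (E.toTrivialization hext S).IsIso (E'.toTrivialization hext S) φ := by
  constructor
  · intro h
    refine ⟨h.map_smul, fun r a => h.map_act r (α a), h.σ_map, fun r₁ r₂ hr hr' => ?_,
      fun r w => congrArg S.t (h.form_map r w)⟩
    refine DiffSpace.ext (h.σ_map r₁) (h.σ_map r₂) ?_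
    refine E'.bundle.principal.div_eq (E'.proj_eq_iff.1 hr') ?_
    refine (h.map_act r₁ _).symm.trans ?_
    exact congrArg φ (E.act_grp_diffHom hext.smooth_right r₁ r₂ hr)
  · intro h
    have hσ : ∀ r, E'.σ (φ r) = E.σ r := h.proj_map
    refine ⟨h.map_smul, fun r b => ?_, hσ, fun r w => ?_⟩
    · have hr : π.proj (E.σ r) = π.proj (E.σ (E.bundle.act r b)) :=
        E.proj_eq_iff.2 (E.bundle.principal.proj_act r b).symm
      have hr' : π.proj (E'.σ (φ r)) = π.proj (E'.σ (φ (E.bundle.act r b))) := by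
        rw [hσ, hσ, hr]
      -- Applied to the pair `(r, r b)`, preservation of `ψ` says that the quotient of `φ (r b)` by
      -- `φ r` is `b`.
      have e := congrArg DiffSpace.grp (h.hom_map r (E.bundle.act r b) hr hr')
      have e₁ : E'.bundle.principal.div (E'.proj_eq_iff.1 hr') = b :=
        e.trans (E.bundle.principal.div_eq (E.proj_eq_iff.1 hr) rfl)
      have e₂ := E'.bundle.principal.act_div (E'.proj_eq_iff.1 hr')
      rw [e₁] at e₂
      exact e₂.symm
    -- The `t`-components agree by hypothesis; the images under `β_*` agree by admissibility, the
    -- chain rule and `σ' ∘ φ = σ`.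
    · refine S.ext_iff.2 ⟨h.form_map r w, ?_⟩
      rw [E.admissible, E'.admissible]
      have h₁ : @Eq P.E (mfderiv R.I P.I (fun r => E'.σ (φ r)) r w)
          (mfderiv R'.I P.I E'.σ (φ r) (mfderiv R.I R'.I φ r w)) :=
        mfderiv_comp_apply (I := R.I) (I' := R'.I) (I'' := P.I) r (g := E'.σ) (f := φ)
          (E'.smooth_σ.mdifferentiable (by simp) _) (φ.contMDiff.mdifferentiable (by simp) _) w
      refine (congrArg (fun w : P.E => (ηπ.form.toFun (E'.σ (φ r)) w : EC)) h₁).symm.trans ?_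
      exact ηπ.form.toFun_mfderiv_congr (I := R.I) hσ r w

/-- The induced bijection on isomorphism classes. -/
def classesEquiv (ηπ : EquivariantConnection π) :
    ExtensionClasses.{u, v} EB β ηπ ≃ TrivializationClasses.{u, v} (liftingGerbe hext S π) :=
  Quot.congr (Equiv.sigmaCongrRight (extensionEquiv hext S ηπ)) fun E E' =>
    exists_congr fun φ => E.2.isIso_iff hext S E'.2 φ

end Correspondence

end

end LiftingGerbe

open LiftingGerbe in
theorem theorem4
    {EG : Type*} [NormedAddCommGroup EG] [NormedSpace ℝ EG]
    {G : Type*} [TopologicalSpace G] [ChartedSpace EG G] [Group G] [LieGroup 𝓘(ℝ, EG) ∞ G]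
    {EA : Type*} [NormedAddCommGroup EA] [NormedSpace ℝ EA]
    {A : Type*} [TopologicalSpace A] [ChartedSpace EA A] [CommGroup A] [LieGroup 𝓘(ℝ, EA) ∞ A]
    {EB : Type*} [NormedAddCommGroup EB] [NormedSpace ℝ EB]
    {B : Type*} [TopologicalSpace B] [ChartedSpace EB B] [Group B] [LieGroup 𝓘(ℝ, EB) ∞ B]
    {EC : Type*} [NormedAddCommGroup EC] [NormedSpace ℝ EC]
    {C : Type*} [TopologicalSpace C] [ChartedSpace EC C] [Group C] [LieGroup 𝓘(ℝ, EC) ∞ C]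
    {α : A →* B} {β : B →* C} (hext : IsCentralExtension EA EB EC α β)
    (S : AdSplitting EA EB EC α β)
    {X : GManifold.{u₁, v₁} EG G} {P : GManifold.{u₂, v₂} EG G}
    (π : EquivariantBundle X P EC C) (ηπ : EquivariantConnection π) :
    ∃ Φ : ∀ R : GManifold.{u, v} EG G,
        AdmissibleExtension EB β ηπ R ≃ ParallelTrivialization (liftingGerbe hext S π) R,
      (∀ (R : GManifold.{u, v} EG G) (E : AdmissibleExtension EB β ηπ R),
        (∀ r : R, (Φ R E).bundle.proj r = E.σ r) ∧
        (∀ (r : R) (a : A), (Φ R E).bundle.act r a = E.bundle.act r (α a)) ∧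
        (∀ (r : R) (w : TangentSpace R.I r),
          (Φ R E).connection.form.toFun r w = S.t (E.connection.form.toFun r w)) ∧
        (∀ (r₁ r₂ : R) h, E.bundle.act r₁ (DiffSpace.grp ((Φ R E).hom r₁ r₂ h)) = r₂)) ∧
      (∀ (R R' : GManifold.{u, v} EG G) (E : AdmissibleExtension EB β ηπ R)
        (E' : AdmissibleExtension EB β ηπ R') (φ : Diffeomorph R.I R'.I R R' ∞),
        E.IsIso E' φ ↔ (Φ R E).IsIso (Φ R' E') φ) ∧
      ∃ Ψ : ExtensionClasses.{u, v} EB β ηπ ≃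
          TrivializationClasses.{u, v} (liftingGerbe hext S π),
        ∀ (R : GManifold.{u, v} EG G) (E : AdmissibleExtension EB β ηπ R),
          Ψ (Quot.mk _ ⟨R, E⟩) = Quot.mk _ ⟨R, Φ R E⟩ := by
  refine ⟨extensionEquiv hext S ηπ, fun R E => ⟨fun _ => rfl, fun _ _ => rfl, fun _ _ => rfl,
    E.act_grp_diffHom hext.smooth_right⟩, fun R R' E E' φ => E.isIso_iff hext S E' φ,
    classesEquiv hext S ηπ, fun _ _ => rfl⟩
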